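/- Let $q\ge 5$ be a prime power. For $t\in\mathbb{F}_q$ put $P(t)=(1,t,t^2,t^3)$, and put $P(\infty)=(0,0,0,1)$. Let $t_1,\dots,t_{q+1}$ be an enumeration of $\mathbb{F}_q\cup\{\infty\}$, let $v_1,\dots,v_{q+1}\in\mathbb{F}_q\setminus\{0\}$, and let $\mathcal{C}\subset\mathbb{F}_q^{q+1}$ be the generalized doubly-extended Reed–Solomon code associated with the twisted cubic, that is, the linear code $\mathcal{C}=\{x\in\mathbb{F}_q^{q+1} : Hx^{tr}=0\}$, where $H$ is the $4\times(q+1)$ matrix whose $j$-th column is $v_jP(t_j)^{tr}$. For a coset $\mathcal{V}=\mathbf{v}+\mathcal{C}$, $\mathbf{v}\in\mathbb{F}_q^{q+1}$, let $B_w(\mathcal{V})$ be the number of vectors of Hamming weight $w$ in $\mathcal{V}$. The weight distribution of $\mathcal{V}$ is the sequence $(B_w(\mathcal{V}))_{w\ge 0}$, and the weight of $\mathcal{V}$ is the smallest Hamming weight of a vector in $\mathcal{V}$. Then the following holds. (i) Cosets of weight $1$ exist, and they all have the same weight distribution. (ii) If $q\not\equiv 1\pmod 3$, cosets of weight $2$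 exist, and they all have the same weight distribution. If $q\equiv 1\pmod 3$, exactly $2$ distinct weight distributions occur among the cosets of weight $2$; the numbers of cosets of weight $2$ having these distributions are $\frac13(q^3-q)(q-1)$ and $\frac16(q^3-q)(q-1)$. (iii) If $q\equiv 1\pmod 3$, exactly $2$ distinct weight distributions occur among the cosets of weight $3$; the numbers of cosets of weight $3$ having these distributions are $(q^2+q)(q-1)$ and $\frac12(q^3-q)(q-1)$. If $q\equiv -1\pmod 3$, exactly $3$ distinct weight distributions occur among the cosets of weight $3$; the numbers of cosets of weight $3$ having these distributions are $(q^2+q)(q-1)$, $\frac13(q^3-q)(q-1)$ and $\frac16(q^3-q)(q-1)$. If $q\equiv 0\pmod 3$, exactly $2$ distinct weight distributions occur among the cosets of weight $3$; the numbers of cosets of weight $3$ having these distributions are $(q^2-1)(q-1)$ and $\frac12(q+1)(q^2-q+2)(q-1)$. -/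

import Mathlib

/-- The point `P(t)` of the twisted cubic in `PG(3,q)`, in homogeneous coordinates:
`P(t) = (1, t, t², t³)` for `t` in the field and `P(∞) = (0, 0, 0, 1)`. -/
def twistedCubicPoint {F : Type*} [Field F] : OnePoint F → Fin 4 → F
  | OnePoint.infty => ![0, 0, 0, 1]
  | OnePoint.some t => ![1, t, t ^ 2, t ^ 3]

/-- The `4 × n` parity check matrix whose `j`-th column is `v j • P(e j)`: a column of homogeneous
coordinates of the point `P(e j)` when `v j ≠ 0`. -/
def cubicParityCheck {F : Type*} [Field F] {ι : Type*} (e : ι → OnePoint F) (v : ι → F) :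
    Matrix (Fin 4) ι F :=
  Matrix.of fun i j => v j * twistedCubicPoint (e j) i

/-- The linear code with parity check matrix `H`: all `x` with `H xᵗʳ = 0`. -/
def codeOfParityCheck {F : Type*} [Field F] {m ι : Type*} [Fintype ι] (H : Matrix m ι F) :
    Submodule F (ι → F) :=
  LinearMap.ker H.mulVecLin

/-- The code associated with the twisted cubic, its points being listed by `e` and written in
homogeneous coordinates with scaling factors `v`. -/
def cubicCode {F : Type*} [Field F] {ι : Type*} [Fintype ι] (e : ι → OnePoint F) (v : ι → F) :
    Submodule F (ι → F) :=
  codeOfParityCheck (cubicParityCheck e v)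

/-- The weight of a coset `V` of `C`: the smallest Hamming weight of a vector of the coset. -/
noncomputable def cosetWeight {F : Type*} [Field F] [DecidableEq F] {ι : Type*} [Fintype ι]
    {C : Submodule F (ι → F)} (V : (ι → F) ⧸ C) : ℕ :=
  sInf {w : ℕ | ∃ x : ι → F, Submodule.Quotient.mk x = V ∧ hammingNorm x = w}

/-- The weight distribution of a coset `V` of `C`: the function `w ↦ B_w(V)`, the number of vectors
of Hamming weight `w` in the coset. -/
noncomputable def cosetWeightDistribution {F : Type*} [Field F] [DecidableEq F] {ι : Type*}
    [Fintype ι] {C : Submodule F (ι → F)} (V : (ι → F) ⧸ C) : ℕ → ℕ :=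
  fun w => {x : ι → F | Submodule.Quotient.mk x = V ∧ hammingNorm x = w}.ncard

/-- The set of all weight distributions that occur among the cosets of `C` of weight `W`. -/
def distributionsOfWeight {F : Type*} [Field F] [DecidableEq F] {ι : Type*} [Fintype ι]
    (C : Submodule F (ι → F)) (W : ℕ) : Set (ℕ → ℕ) :=
  {D | ∃ V : (ι → F) ⧸ C, cosetWeight V = W ∧ cosetWeightDistribution V = D}

/-- The number of cosets of `C` of weight `W` that have the weight distribution `D`. -/
noncomputable def numCosets {F : Type*} [Field F] [DecidableEq F] {ι : Type*} [Fintype ι]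
    (C : Submodule F (ι → F)) (W : ℕ) (D : ℕ → ℕ) : ℕ :=
  {V : (ι → F) ⧸ C | cosetWeight V = W ∧ cosetWeightDistribution V = D}.ncard

/-! Two vectors share a coset exactly when they share a syndrome, and rescaling and relabelling
coordinates preserves Hamming weight. So cosets become vectors s of F^4, and words become linear
combinations of the points P(t). Any four of these points form a basis of F^4. Hence the numbers of
words of weight at most three with syndrome s determine the whole distribution
(`syndromeCount_eq_of_lt`), and those of weight at most two depend only on the weight of the coset.
Among cosets of one weight, a distribution therefore amounts to the single number B_3
(`syndromeCount_eq_iff`).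

To find B_3, note that every s lies on a chord, a tangent or an imaginary chord of the cubic
(`exists_chord`). In each case a projective coordinate φ with values in a group G of order n turns
"s lies in the plane through P(i), P(j), P(k)" into φ(i)φ(j)φ(k) = c. For cosets of weight two
(chords) G is the multiplicative group, n = q - 1; for tangents it is the additive group, n = q; for
imaginary chords it is the group of (q+1)-th roots of unity, n = q + 1. Counting triples of distinct
elements gives 6 B_3 = n^2 - 3n + 2r, with r the number of cube roots of c
(`card_distinct_triples_prod`, `six_mul_syndromeCount_three`). If 3 does not divide n then r = 1; if
it does, r is 0 or 3 for cyclic G, and 0 or q for the additive group. As 3 divides exactly one of q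
- 1, q, q + 1, exactly one of the three families splits in two.

The sizes of the families are counted directly. The sizes of the two halves of the split family
follow from a linear system: they add up to the family, and the sum of B_3 over all s is the number
of words of weight three. -/

open Finset

/-! ### Words with a given syndrome, for an arbitrary linear map -/

section SyndromeCount

variable {F : Type*} [Field F] [DecidableEq F] {X : Type*} [Fintype X]

/-- The set of coordinates at which a word does not vanish. -/
def wordSupport (x : X → F) : Finset X := {i | x i ≠ 0}

@[simp] lemma mem_wordSupport {x : X → F} {i : X} : i ∈ wordSupport x ↔ x i ≠ 0 := by
  simp [wordSupport]

lemma card_wordSupport (x : X → F) : #(wordSupport x) = hammingNorm x := rfl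

variable [Fintype F] [DecidableEq X] {V : Type*} [AddCommGroup V] [Module F V] [DecidableEq V]

/-- The number of words of weight `w` with syndrome `s`. -/
def syndromeCount (f : (X → F) →ₗ[F] V) (s : V) (w : ℕ) : ℕ :=
  #{x : X → F | f x = s ∧ hammingNorm x = w}

/-- Double counting of pairs (x, S) with the support of x inside S: a word of weight w lies in (N -
w choose k - w) sets of size k, where N is the length. -/
lemma sum_card_supported (f : (X → F) →ₗ[F] V) (s : V) (k : ℕ) :
    ∑ S ∈ powersetCard k (univ : Finset X), #{x : X → F | f x = s ∧ wordSupport x ⊆ S} =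
      ∑ w ∈ range (k + 1), syndromeCount f s w * (Fintype.card X - w).choose (k - w) := by
  have h1 : ∀ S : Finset X, #{x : X → F | f x = s ∧ wordSupport x ⊆ S} =
      ∑ x : X → F with f x = s, if wordSupport x ⊆ S then 1 else 0 := by
    intro S
    rw [card_eq_sum_ones, ← filter_filter, sum_filter]
  have h2 : ∀ x : X → F, (∑ S ∈ powersetCard k (univ : Finset X),
      if wordSupport x ⊆ S then 1 else 0) =
      ∑ w ∈ range (k + 1), if hammingNorm x = w then (Fintype.card X - w).choose (k - w) else 0 := by
    intro x
    rw [← sum_filter, ← card_eq_sum_ones, sum_ite_eq]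
    split_ifs with h
    · rw [mem_range, Nat.lt_succ_iff] at h
      exact card_filter_powersetCard_subset (wordSupport x) _ _ (subset_univ _) h
    · rw [card_eq_zero, filter_eq_empty_iff]
      intro S hS hx
      rw [mem_powersetCard_univ] at hS
      have := card_le_card hx
      rw [hS, card_wordSupport] at this
      exact h (mem_range.2 (Nat.lt_succ_of_le this))
  simp_rw [h1]
  rw [sum_comm]
  simp_rw [h2]
  rw [sum_comm]
  refine sum_congr rfl fun w _ => ?_
  rw [← sum_filter, sum_const, smul_eq_mul, filter_filter]
  rfl

/-- If every `d` coordinates already realise all syndromes, then the numbers of words of weight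
less than `d` in a coset determine its weight distribution. -/
theorem syndromeCount_eq_of_lt (f : (X → F) →ₗ[F] V) (d : ℕ)
    (hf : ∀ S : Finset X, d ≤ #S → ∀ v, ∃ x, wordSupport x ⊆ S ∧ f x = v) {s s' : V}
    (h : ∀ w < d, syndromeCount f s w = syndromeCount f s' w) :
    syndromeCount f s = syndromeCount f s' := by
  funext k
  induction k using Nat.strong_induction_on with
  | _ k ih =>
    rcases lt_or_ge k d with hk | hk
    · exact h k hk
    -- For a fixed S of size at least d, translation by a word y supported in S with syndrome s' - s
    -- matches the two fibres, so both sides are equal term by term.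
    have key : ∑ S ∈ powersetCard k (univ : Finset X), #{x : X → F | f x = s ∧ wordSupport x ⊆ S} =
        ∑ S ∈ powersetCard k (univ : Finset X), #{x : X → F | f x = s' ∧ wordSupport x ⊆ S} := by
      refine sum_congr rfl fun S hS => ?_
      rw [mem_powersetCard_univ] at hS
      obtain ⟨y, hyS, hy⟩ := hf S (hS ▸ hk) (s' - s)
      have aux : ∀ x : X → F, wordSupport x ⊆ S ↔ ∀ i, i ∉ S → x i = 0 := by
        intro x
        simp only [subset_iff, mem_wordSupport]
        exact forall_congr' fun i => not_imp_comm
      rw [aux] at hyS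
      refine card_bij' (fun x _ => x + y) (fun x _ => x - y) ?_ ?_ (by simp) (by simp)
      · simp only [mem_filter, mem_univ, true_and, aux]
        rintro x ⟨rfl, hx⟩
        exact ⟨by simp [hy], fun i hi => by simp [hx i hi, hyS i hi]⟩
      · simp only [mem_filter, mem_univ, true_and, aux]
        rintro x ⟨rfl, hx⟩
        exact ⟨by simp [hy], fun i hi => by simp [hx i hi, hyS i hi]⟩
    -- The terms with w < k agree by induction and cancel; the term w = k has binomial coefficient
    -- 1.
    rw [sum_card_supported, sum_card_supported, sum_range_succ, sum_range_succ,
      sum_congr rfl fun w hw => by rw [ih w (mem_range.1 hw)]] at key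
    simpa using key

lemma sum_syndromeCount [Fintype V] (f : (X → F) →ₗ[F] V) (w : ℕ) :
    ∑ s, syndromeCount f s w = #{x : X → F | hammingNorm x = w} := by
  rw [card_eq_sum_card_fiberwise (f := f) (t := univ) (by simp [Set.MapsTo])]
  refine sum_congr rfl fun s _ => ?_
  rw [filter_filter, syndromeCount]
  simp only [and_comm]

lemma card_hammingNorm_eq (w : ℕ) : #{x : X → F | hammingNorm x = w} =
    (Fintype.card X).choose w * (Fintype.card F - 1) ^ w := by
  rw [card_eq_sum_card_fiberwise (f := wordSupport) (t := powersetCard w univ)]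
  · rw [← card_univ, ← card_powersetCard, ← smul_eq_mul, ← sum_const]
    refine sum_congr rfl fun S hS => ?_
    rw [mem_powersetCard_univ] at hS
    have : ({x ∈ ({x | hammingNorm x = w} : Finset (X → F)) | wordSupport x = S}) =
        Fintype.piFinset fun i => if i ∈ S then univ.erase (0 : F) else {0} := by
      ext x
      simp only [mem_filter, mem_univ, true_and, Fintype.mem_piFinset]
      constructor
      · rintro ⟨-, rfl⟩ i
        by_cases hi : x i = 0 <;> simp [hi]
      · intro h
        have : wordSupport x = S := by
          ext i
          have := h i
          by_cases hi : i ∈ S <;> simp_all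
        exact ⟨by rw [← card_wordSupport, this, hS], this⟩
    rw [this, Fintype.card_piFinset]
    simp [apply_ite, hS, card_univ]
  · intro x hx
    simpa [card_wordSupport] using hx

end SyndromeCount

/-! ### Triples with given product and cube roots in a finite abelian group -/

section Group

variable {G : Type*} [CommGroup G] [Fintype G] [DecidableEq G]

/-- The number of ordered triples of distinct elements with a given product. -/
theorem card_distinct_triples_prod (c : G) :
    #{t : G × G × G | (t.1 ≠ t.2.1 ∧ t.1 ≠ t.2.2 ∧ t.2.1 ≠ t.2.2) ∧ t.1 * t.2.1 * t.2.2 = c} +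
      3 * Fintype.card G = Fintype.card G ^ 2 + 2 * #{x : G | x ^ 3 = c} := by
  -- The third entry is c / (xy); it differs from x iff x²y ≠ c, and from y iff xy² ≠ c.
  have e : #{t : G × G × G | (t.1 ≠ t.2.1 ∧ t.1 ≠ t.2.2 ∧ t.2.1 ≠ t.2.2) ∧
      t.1 * t.2.1 * t.2.2 = c} =
      #{p : G × G | p.1 ≠ p.2 ∧ p.1 ^ 2 * p.2 ≠ c ∧ p.1 * p.2 ^ 2 ≠ c} := by
    refine card_bij' (fun t _ => (t.1, t.2.1)) (fun p _ => (p.1, p.2, c / (p.1 * p.2))) ?_ ?_ ?_ ?_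
    · simp only [mem_filter, mem_univ, true_and, Prod.forall]
      rintro x y z ⟨⟨h1, h2, h3⟩, rfl⟩
      refine ⟨h1, fun h => h2 ?_, fun h => h3 ?_⟩
      · rw [pow_two, mul_assoc, mul_assoc, mul_left_cancel_iff, mul_comm, mul_left_cancel_iff] at h
        exact h
      · rw [pow_two, mul_assoc, mul_left_cancel_iff, mul_left_cancel_iff] at h
        exact h
    · simp only [mem_filter, mem_univ, true_and, Prod.forall]
      rintro x y ⟨h1, h2, h3⟩
      refine ⟨⟨h1, fun h => h2 ?_, fun h => h3 ?_⟩, mul_div_cancel _ _⟩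
      · rw [eq_div_iff_mul_eq'] at h
        rw [← h, pow_two, mul_assoc, mul_comm]
      · rw [eq_div_iff_mul_eq'] at h
        rw [← h, pow_two, mul_left_comm]
    · simp only [mem_filter, mem_univ, true_and, Prod.forall, Prod.mk.injEq]
      rintro x y z ⟨-, rfl⟩
      simp
    · simp
  have h1 : #{p : G × G | p.1 = p.2} = Fintype.card G := by
    rw [← card_univ]
    exact card_nbij' (fun p => p.1) (fun x => (x, x)) (by simp) (by simp)
      (by simp +contextual [Set.LeftInvOn]) (by simp [Set.LeftInvOn])
  have h2 : #{p : G × G | p.1 ^ 2 * p.2 = c} = Fintype.card G := by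
    rw [← card_univ]
    refine card_nbij' (fun p => p.1) (fun x => (x, c / x ^ 2)) (by simp) (by simp) ?_ ?_
    · rintro ⟨x, y⟩ h
      simp at h
      simp [← h]
    · intro x _
      rfl
  have h3 : #{p : G × G | p.1 * p.2 ^ 2 = c} = Fintype.card G := by
    rw [← card_univ]
    refine card_nbij' (fun p => p.2) (fun x => (c / x ^ 2, x)) (by simp) (by simp) ?_ ?_
    · rintro ⟨x, y⟩ h
      simp at h
      simp [← h]
    · intro x _
      rfl
  have h4 : ∀ P : G × G → Prop, [DecidablePred P] → (∀ p, P p → p.1 = p.2) →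
      (∀ x, P (x, x) ↔ x ^ 3 = c) → #{p : G × G | P p} = #{x : G | x ^ 3 = c} := by
    intro P _ hP hP'
    refine card_nbij' (fun p => p.1) (fun x => (x, x)) ?_ ?_ ?_ ?_
    · rintro ⟨x, y⟩ h
      simp only [coe_filter, mem_univ, true_and, Set.mem_ofPred_eq] at h ⊢
      obtain rfl : x = y := hP _ h
      exact (hP' x).1 h
    · intro x h
      simpa [hP'] using h
    · rintro ⟨x, y⟩ h
      simp only [coe_filter, mem_univ, true_and, Set.mem_ofPred_eq] at h
      obtain rfl : x = y := hP _ h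
      rfl
    · intro x _
      rfl
  have cube : ∀ x : G, x ^ 2 * x = x ^ 3 ∧ x * x ^ 2 = x ^ 3 := fun x =>
    ⟨(pow_succ x 2).symm, (pow_succ' x 2).symm⟩
  have eqof : ∀ p : G × G, p.1 ^ 2 * p.2 = c → p.1 * p.2 ^ 2 = c → p.1 = p.2 := by
    rintro ⟨x, y⟩ h h'
    simp only at h h' ⊢
    rw [← h', pow_two, pow_two, mul_assoc, mul_left_cancel_iff, mul_right_cancel_iff] at h
    exact h
  -- Inclusion–exclusion: each of `A`, `B`, `C` has n elements and any two of them meet only on the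
  -- diagonal, at cube roots of c. Hence the union has 3n - 2r elements.
  set A : Finset (G × G) := {p | p.1 = p.2}
  set B : Finset (G × G) := {p | p.1 ^ 2 * p.2 = c}
  set C : Finset (G × G) := {p | p.1 * p.2 ^ 2 = c}
  have hAB : #(A ∩ B) = #{x : G | x ^ 3 = c} := by
    rw [← filter_and]
    exact h4 _ (fun p h => h.1) (fun x => by simp [cube])
  have hAC : #((A ∪ B) ∩ C) = #{x : G | x ^ 3 = c} := by
    rw [← filter_or, ← filter_and]
    refine h4 _ ?_ (fun x => by simp [cube])
    rintro p ⟨h | h, h'⟩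
    · exact h
    · exact eqof p h h'
  have hcompl : ({p : G × G | p.1 ≠ p.2 ∧ p.1 ^ 2 * p.2 ≠ c ∧ p.1 * p.2 ^ 2 ≠ c} :
      Finset (G × G)) = (A ∪ B ∪ C)ᶜ := by
    ext p
    simp [A, B, C]
  have hcard := card_compl_add_card (A ∪ B ∪ C)
  have hu1 := card_union_add_card_inter (A ∪ B) C
  have hu2 := card_union_add_card_inter A B
  rw [e, hcompl]
  rw [Fintype.card_prod, ← pow_two] at hcard
  lia

lemma card_cube_roots_of_coprime (h : (Fintype.card G).Coprime 3) (c : G) :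
    #{x : G | x ^ 3 = c} = 1 := by
  rw [card_eq_one]
  refine ⟨(powCoprime (by rwa [Nat.card_eq_fintype_card])).symm c, ?_⟩
  ext x
  rw [mem_filter_univ, mem_singleton, Equiv.eq_symm_apply]
  rfl

/-- If a cube root exists, the set of all of them is a coset of the kernel of cubing, which has
order gcd(n, 3) = 3 in a cyclic group. -/
lemma card_cube_roots_of_dvd [IsCyclic G] (h : 3 ∣ Fintype.card G) (c : G) :
    #{x : G | x ^ 3 = c} = 0 ∨ #{x : G | x ^ 3 = c} = 3 := by
  rcases Finset.eq_empty_or_nonempty {x : G | x ^ 3 = c} with h0 | ⟨y, hy⟩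
  · exact Or.inl (card_eq_zero.2 h0)
  · right
    have := IsCyclic.card_powMonoidHom_ker G 3
    rw [Nat.card_eq_fintype_card (α := G), Nat.gcd_eq_right h] at this
    refine Eq.trans ?_ this
    rw [← Fintype.card_coe, ← Nat.card_eq_fintype_card]
    rw [mem_filter_univ] at hy
    refine Nat.card_congr
      { toFun := fun x => ⟨x / y, ?_⟩
        invFun := fun x => ⟨x * y, ?_⟩
        left_inv := fun x => by simp
        right_inv := fun x => by simp }
    · have := x.2
      rw [mem_filter_univ] at this
      simp [MonoidHom.mem_ker, div_pow, this, hy]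
    · have := x.2
      rw [MonoidHom.mem_ker, powMonoidHom_apply] at this
      simp [mul_pow, this, hy]

end Group

/-! ### Ordered triples and three-element sets -/

section Triples

variable {X : Type*} [Fintype X] [DecidableEq X]

/-- Every set of three elements is enumerated by six ordered triples. -/
theorem card_distinct_triples_eq_six_mul (P : Finset X → Prop) [DecidablePred P] :
    #{t : X × X × X | (t.1 ≠ t.2.1 ∧ t.1 ≠ t.2.2 ∧ t.2.1 ≠ t.2.2) ∧ P {t.1, t.2.1, t.2.2}} =
      6 * #{S ∈ powersetCard 3 (univ : Finset X) | P S} := by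
  rw [card_eq_sum_card_fiberwise (f := fun t => ({t.1, t.2.1, t.2.2} : Finset X))
    (t := {S ∈ powersetCard 3 (univ : Finset X) | P S}), mul_comm, ← smul_eq_mul, ← sum_const]
  · refine sum_congr rfl fun S hS => ?_
    rw [mem_filter, mem_powersetCard_univ, card_eq_three] at hS
    obtain ⟨⟨a, b, c, hab, hac, hbc, rfl⟩, hP⟩ := hS
    have : ({t ∈ ({t | (t.1 ≠ t.2.1 ∧ t.1 ≠ t.2.2 ∧ t.2.1 ≠ t.2.2) ∧ P {t.1, t.2.1, t.2.2}} :
        Finset (X × X × X)) | ({t.1, t.2.1, t.2.2} : Finset X) = {a, b, c}}) =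
        {(a, b, c), (a, c, b), (b, a, c), (b, c, a), (c, a, b), (c, b, a)} := by
      ext ⟨x, y, z⟩
      simp only [mem_filter, mem_univ, true_and, mem_insert, mem_singleton, Prod.mk.injEq]
      constructor
      · rintro ⟨⟨⟨h1, h2, h3⟩, -⟩, h⟩
        have hx : x ∈ ({a, b, c} : Finset X) := h ▸ by simp
        have hy : y ∈ ({a, b, c} : Finset X) := h ▸ by simp
        have hz : z ∈ ({a, b, c} : Finset X) := h ▸ by simp
        simp only [mem_insert, mem_singleton] at hx hy hz
        grind
      · intro h
        have : ({x, y, z} : Finset X) = {a, b, c} := by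
          ext w
          simp only [mem_insert, mem_singleton]
          grind
        refine ⟨⟨?_, this ▸ hP⟩, this⟩
        grind
    rw [this]
    rw [card_insert_of_notMem, card_insert_of_notMem, card_insert_of_notMem,
      card_insert_of_notMem, card_insert_of_notMem, card_singleton] <;>
    · simp only [mem_insert, mem_singleton, Prod.mk.injEq]
      grind
  · rintro ⟨x, y, z⟩ ht
    simp only [coe_filter, mem_univ, true_and, Set.mem_ofPred_eq, mem_powersetCard_univ] at ht ⊢
    exact ⟨card_eq_three.2 ⟨x, y, z, ht.1.1, ht.1.2.1, ht.1.2.2, rfl⟩, ht.2⟩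

end Triples

/-! ### Points of the space as symmetric trilinear forms -/

section CubicForm

variable {R : Type*} [CommRing R]

/-- The bracket of two vectors of the plane. -/
def bracket (u v : R × R) : R := u.1 * v.2 - u.2 * v.1

/-- A point of the projective space, seen as a symmetric trilinear form on the plane: at `u v w` it
is the value of the point on the binary cubic form with roots `u`, `v`, `w`. -/
def cubicForm (u v w : R × R) : (Fin 4 → R) →ₗ[R] R :=
  Fintype.linearCombination R ![-(u.2 * v.2 * w.2),
    u.1 * v.2 * w.2 + u.2 * v.1 * w.2 + u.2 * v.2 * w.1,
    -(u.1 * v.1 * w.2 + u.1 * v.2 * w.1 + u.2 * v.1 * w.1), u.1 * v.1 * w.1]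

lemma cubicForm_apply (u v w : R × R) (s : Fin 4 → R) : cubicForm u v w s =
    -(u.2 * v.2 * w.2) * s 0 + (u.1 * v.2 * w.2 + u.2 * v.1 * w.2 + u.2 * v.2 * w.1) * s 1 -
    (u.1 * v.1 * w.2 + u.1 * v.2 * w.1 + u.2 * v.1 * w.1) * s 2 + u.1 * v.1 * w.1 * s 3 := by
  simp [cubicForm, Fintype.linearCombination_apply, Fin.sum_univ_four]
  ring

end CubicForm

/-! ### Chords, tangents and independence of points of the twisted cubic -/

section TwistedCubic

variable {F : Type*} [Field F]

/-- Homogeneous coordinates on the projective line. -/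
def lineCoord : OnePoint F → F × F
  | OnePoint.infty => (0, 1)
  | OnePoint.some t => (1, t)

/-- A vector completing `lineCoord i` to a basis of the plane. -/
def lineCocoord : OnePoint F → F × F
  | OnePoint.infty => (1, 0)
  | OnePoint.some _ => (0, 1)

/-- A second point on the tangent to the twisted cubic. -/
def tangentPoint : OnePoint F → Fin 4 → F
  | OnePoint.infty => ![0, 0, 1, 0]
  | OnePoint.some t => ![0, 1, 2 * t, 3 * t ^ 2]

lemma bracket_lineCoord_eq_zero {i j : OnePoint F} :
    bracket (lineCoord i) (lineCoord j) = 0 ↔ i = j := by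
  cases i using OnePoint.rec <;> cases j using OnePoint.rec <;>
    simp [bracket, lineCoord, sub_eq_zero, eq_comm]

lemma bracket_lineCocoord_ne_zero (i : OnePoint F) :
    bracket (lineCoord i) (lineCocoord i) ≠ 0 := by
  cases i using OnePoint.rec <;> simp [bracket, lineCoord, lineCocoord]

/-- As a trilinear form, a point of the cubic is a product of three copies of one linear form. This
is what makes coplanarity conditions multiplicative. -/
lemma cubicForm_twistedCubicPoint (u v w : F × F) (i : OnePoint F) :
    cubicForm u v w (twistedCubicPoint i) =
      bracket u (lineCoord i) * bracket v (lineCoord i) * bracket w (lineCoord i) := by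
  rw [cubicForm_apply]
  cases i using OnePoint.rec <;> simp [bracket, lineCoord, twistedCubicPoint]
  ring

/-- The tangent point is the first-order variation of P(i) when `lineCoord i` moves in the direction
`lineCocoord i`; the three terms come from the product rule. -/
lemma cubicForm_tangentPoint (u v w : F × F) (i : OnePoint F) :
    cubicForm u v w (tangentPoint i) =
      bracket u (lineCocoord i) * bracket v (lineCoord i) * bracket w (lineCoord i) +
      bracket u (lineCoord i) * bracket v (lineCocoord i) * bracket w (lineCoord i) +
      bracket u (lineCoord i) * bracket v (lineCoord i) * bracket w (lineCocoord i) := by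
  rw [cubicForm_apply]
  cases i using OnePoint.rec <;> simp [bracket, lineCoord, lineCocoord, tangentPoint] <;> ring

/-- Every point lies on a chord, a tangent or an imaginary chord of the twisted cubic. -/
theorem exists_chord (s : Fin 4 → F) :
    (∃ (a b : OnePoint F) (α β : F), a ≠ b ∧
      s = α • twistedCubicPoint a + β • twistedCubicPoint b) ∨
    (∃ (a : OnePoint F) (α β : F), s = α • twistedCubicPoint a + β • tangentPoint a) ∨
    ∃ b c : F, (∀ r, r ^ 2 + b * r + c ≠ 0) ∧ s 2 = -b * s 1 - c * s 0 ∧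
      s 3 = -b * s 2 - c * s 1 := by
  -- A nonzero binary quadratic form g apolar to s: the 2 × 3 Hankel matrix of s has a nontrivial
  -- kernel. The roots of g, counted with infinity, tell which line carries s: distinct rational
  -- roots give a chord, a double root a tangent, no rational root an imaginary chord.
  obtain ⟨g, hg0, hg1, hg2⟩ : ∃ g : Fin 3 → F, g ≠ 0 ∧
      g 0 * s 0 + g 1 * s 1 + g 2 * s 2 = 0 ∧ g 0 * s 1 + g 1 * s 2 + g 2 * s 3 = 0 := by
    have := LinearMap.ker_ne_bot_of_finrank_lt
      (f := (!![s 0, s 1, s 2; s 1, s 2, s 3] : Matrix (Fin 2) (Fin 3) F).mulVecLin) (by simp)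
    obtain ⟨g, hg, hg0⟩ := Submodule.exists_mem_ne_zero_of_ne_bot this
    refine ⟨g, hg0, ?_, ?_⟩
    · have := congrFun (LinearMap.mem_ker.1 hg) 0
      simp [Matrix.mulVec, dotProduct, Fin.sum_univ_three] at this
      linear_combination this
    · have := congrFun (LinearMap.mem_ker.1 hg) 1
      simp [Matrix.mulVec, dotProduct, Fin.sum_univ_three] at this
      linear_combination this
  by_cases h2 : g 2 = 0
  · by_cases h1 : g 1 = 0
    · have h0 : g 0 ≠ 0 := by
        intro h0
        apply hg0
        ext i
        fin_cases i <;> simp [h0, h1, h2]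
      -- Here g is constant, which is a double root at infinity.
      refine Or.inr (Or.inl ⟨OnePoint.infty, s 3, s 2, ?_⟩)
      simp [h1, h2, h0] at hg1 hg2
      ext i
      fin_cases i <;> simp [twistedCubicPoint, tangentPoint, hg1, hg2]
    -- Here g is linear: one root at infinity, the other at r.
    · obtain ⟨r, hr⟩ : ∃ r, g 0 = - r * g 1 := ⟨-(g 0 / g 1), by field_simp⟩
      have e1 : s 1 = r * s 0 := mul_left_cancel₀ h1 (by linear_combination hg1 - s 0 * hr - s 2 * h2)
      have e2 : s 2 = r * s 1 := mul_left_cancel₀ h1 (by linear_combination hg2 - s 1 * hr - s 3 * h2)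
      refine Or.inl ⟨r, OnePoint.infty, s 0, s 3 - r ^ 3 * s 0, OnePoint.coe_ne_infty r, ?_⟩
      ext i
      fin_cases i <;> simp [twistedCubicPoint, e1, e2] <;> ring
  · obtain ⟨b, hb⟩ : ∃ b, g 1 = b * g 2 := ⟨g 1 / g 2, by field_simp⟩
    obtain ⟨c, hc⟩ : ∃ c, g 0 = c * g 2 := ⟨g 0 / g 2, by field_simp⟩
    have e2 : s 2 = -b * s 1 - c * s 0 :=
      mul_left_cancel₀ h2 (by linear_combination hg1 - s 0 * hc - s 1 * hb)
    have e3 : s 3 = -b * s 2 - c * s 1 :=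
      mul_left_cancel₀ h2 (by linear_combination hg2 - s 1 * hc - s 2 * hb)
    by_cases hroot : ∃ r, r ^ 2 + b * r + c = 0
    · obtain ⟨r, hr⟩ := hroot
      obtain ⟨r', rfl⟩ : ∃ r', b = -(r + r') := ⟨-b - r, by ring⟩
      obtain rfl : c = r * r' := by linear_combination hr
      by_cases hrr : r = r'
      · subst hrr
        refine Or.inr (Or.inl ⟨r, s 0, s 1 - r * s 0, ?_⟩)
        ext i
        fin_cases i <;> simp [twistedCubicPoint, tangentPoint, e3, e2] <;> ring
      · have hd : r - r' ≠ 0 := sub_ne_zero.2 hrr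
        have hd' : r' - r ≠ 0 := sub_ne_zero.2 (Ne.symm hrr)
        -- The coefficients solve α + β = s 0 and αr + βr' = s 1; the recurrence given by g does the
        -- rest.
        refine Or.inl ⟨r, r', (s 1 - r' * s 0) / (r - r'), (r * s 0 - s 1) / (r - r'),
          fun h => hrr (OnePoint.coe_injective h), ?_⟩
        ext i
        fin_cases i <;> simp [twistedCubicPoint, e3, e2] <;> field_simp <;> ring
    · push Not at hroot
      exact Or.inr (Or.inr ⟨b, c, hroot, e2, e3⟩)

instance OnePoint.instDecidableEq {α : Type*} [DecidableEq α] : DecidableEq (OnePoint α) :=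
  inferInstanceAs (DecidableEq (Option α))

lemma OnePoint.card_eq {α : Type*} [Fintype α] :
    Fintype.card (OnePoint α) = Fintype.card α + 1 :=
  Fintype.card_option

variable [Fintype F]

variable (F) in
/-- The syndrome of a word indexed by the points of the twisted cubic. -/
def cubicSyndrome : (OnePoint F → F) →ₗ[F] (Fin 4 → F) :=
  Fintype.linearCombination F twistedCubicPoint

lemma cubicSyndrome_apply (x : OnePoint F → F) :
    cubicSyndrome F x = ∑ i, x i • twistedCubicPoint i := rfl

lemma cubicForm_cubicSyndrome (u v w : F × F) (x : OnePoint F → F) :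
    cubicForm u v w (cubicSyndrome F x) = ∑ i, x i *
      (bracket u (lineCoord i) * bracket v (lineCoord i) * bracket w (lineCoord i)) := by
  simp [cubicSyndrome_apply, cubicForm_twistedCubicPoint]

variable [DecidableEq F]

/-- The trilinear form at j, k, l kills the points P(j), P(k), P(l), so it isolates the coordinate
at i. -/
lemma cubicForm_cubicSyndrome_of_subset {i j k l : OnePoint F} {x : OnePoint F → F}
    (hx : wordSupport x ⊆ {i, j, k, l}) :
    cubicForm (lineCoord j) (lineCoord k) (lineCoord l) (cubicSyndrome F x) = x i *
      (bracket (lineCoord j) (lineCoord i) * bracket (lineCoord k) (lineCoord i) *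
        bracket (lineCoord l) (lineCoord i)) := by
  rw [cubicForm_cubicSyndrome]
  refine sum_eq_single i (fun m _ hm => ?_) (by simp)
  by_cases h : x m = 0
  · simp [h]
  · have : m ∈ ({i, j, k, l} : Finset _) := hx (by simpa using h)
    simp only [mem_insert, mem_singleton, hm, false_or] at this
    rcases this with rfl | rfl | rfl <;> simp [bracket_lineCoord_eq_zero.2 rfl]

/-- Any four points of the twisted cubic are independent. -/
theorem eq_zero_of_cubicSyndrome_eq_zero (hq : 3 ≤ Fintype.card F) {x : OnePoint F → F}
    (hx : cubicSyndrome F x = 0) {S : Finset (OnePoint F)} (hS : #S ≤ 4) (hxS : wordSupport x ⊆ S) :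
    x = 0 := by
  by_contra h
  obtain ⟨i, hi⟩ := Function.ne_iff.1 h
  have hiS : i ∈ S := hxS (by simpa using hi)
  -- The rest of S is padded to exactly three points other than i; this needs q + 1 ≥ 4.
  obtain ⟨U, hU1, hU2, hU3⟩ := exists_subsuperset_card_eq (s := S.erase i) (t := univ.erase i)
    (n := 3) (erase_subset_erase _ (subset_univ _)) (by rw [card_erase_of_mem hiS]; lia)
    (by rw [card_erase_of_mem (mem_univ _), card_univ, OnePoint.card_eq]; lia)
  obtain ⟨j, k, l, -, -, -, rfl⟩ := card_eq_three.1 hU3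
  have hsub : wordSupport x ⊆ {i, j, k, l} :=
    hxS.trans (fun m hm => by
      by_cases hmi : m = i
      · simp [hmi]
      · exact mem_insert_of_mem (hU1 (mem_erase.2 ⟨hmi, hm⟩)))
  have := cubicForm_cubicSyndrome_of_subset hsub
  rw [hx, map_zero] at this
  have hj := (mem_erase.1 (hU2 (show j ∈ ({j, k, l} : Finset _) by simp))).1
  have hk := (mem_erase.1 (hU2 (show k ∈ ({j, k, l} : Finset _) by simp))).1
  have hl := (mem_erase.1 (hU2 (show l ∈ ({j, k, l} : Finset _) by simp))).1
  have hi' : x i ≠ 0 := hi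
  simp [bracket_lineCoord_eq_zero, hj, hk, hl, hi'] at this

theorem eq_of_cubicSyndrome_eq (hq : 3 ≤ Fintype.card F) {x y : OnePoint F → F}
    (hxy : cubicSyndrome F x = cubicSyndrome F y) (h : #(wordSupport x ∪ wordSupport y) ≤ 4) :
    x = y := by
  refine sub_eq_zero.1 (eq_zero_of_cubicSyndrome_eq_zero hq (by rw [map_sub, hxy, sub_self]) h ?_)
  intro i hi
  simp only [mem_wordSupport, mem_union, Pi.sub_apply] at hi ⊢
  by_contra! h0
  exact hi (by rw [h0.1, h0.2, sub_zero])

theorem eq_of_cubicSyndrome_eq_of_hammingNorm (hq : 3 ≤ Fintype.card F) {x y : OnePoint F → F}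
    (hxy : cubicSyndrome F x = cubicSyndrome F y) (h : hammingNorm x + hammingNorm y ≤ 4) :
    x = y :=
  eq_of_cubicSyndrome_eq hq hxy ((card_union_le _ _).trans h)

/-- Any four points of the twisted cubic span the space. -/
theorem exists_cubicSyndrome_eq (hq : 3 ≤ Fintype.card F) (S : Finset (OnePoint F)) (hS : 4 ≤ #S)
    (s : Fin 4 → F) : ∃ x, wordSupport x ⊆ S ∧ cubicSyndrome F x = s := by
  obtain ⟨U, hUS, hU⟩ := exists_subset_card_eq hS
  let f : (U → F) →ₗ[F] (OnePoint F → F) := Function.ExtendByZero.linearMap F Subtype.val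
  have hf : ∀ y, wordSupport (f y) ⊆ U := by
    intro y i hi
    by_contra h
    rw [mem_wordSupport] at hi
    exact hi (Function.extend_apply' _ _ _ (by simpa using h))
  -- Restricted to four coordinates, the syndrome map is injective by independence, hence onto, both
  -- sides having dimension four.
  have hinj : Function.Injective (cubicSyndrome F ∘ₗ f) := by
    rw [← LinearMap.ker_eq_bot, LinearMap.ker_eq_bot']
    intro y hy
    have := eq_zero_of_cubicSyndrome_eq_zero hq hy hU.le (hf y)
    ext i
    have h := congrFun this i
    rwa [Function.ExtendByZero.linearMap_apply, Subtype.val_injective.extend_apply] at h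
  obtain ⟨y, hy⟩ := (LinearMap.injective_iff_surjective_of_finrank_eq_finrank
    (by simp [hU])).1 hinj s
  exact ⟨f y, (hf y).trans hUS, hy⟩

theorem syndromeCount_cubicSyndrome_eq (hq : 3 ≤ Fintype.card F) {s s' : Fin 4 → F}
    (h : ∀ w < 4, syndromeCount (cubicSyndrome F) s w = syndromeCount (cubicSyndrome F) s' w) :
    syndromeCount (cubicSyndrome F) s = syndromeCount (cubicSyndrome F) s' :=
  syndromeCount_eq_of_lt _ 4 (exists_cubicSyndrome_eq hq) h

/-- A point lies in the plane through three points of the twisted cubic if and only if its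
trilinear form vanishes on them. -/
theorem cubicForm_eq_zero_iff (hq : 3 ≤ Fintype.card F) {i j k : OnePoint F} (hij : i ≠ j)
    (hik : i ≠ k) (hjk : j ≠ k) (s : Fin 4 → F) :
    cubicForm (lineCoord i) (lineCoord j) (lineCoord k) s = 0 ↔
      ∃ x, wordSupport x ⊆ {i, j, k} ∧ cubicSyndrome F x = s := by
  have h3 : #({i, j, k} : Finset (OnePoint F)) = 3 := card_eq_three.2 ⟨_, _, _, hij, hik, hjk, rfl⟩
  obtain ⟨l, hl⟩ : ∃ l, l ∉ ({i, j, k} : Finset (OnePoint F)) := by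
    by_contra! h
    have := card_le_card (fun l _ => h l : univ ⊆ ({i, j, k} : Finset (OnePoint F)))
    rw [card_univ, OnePoint.card_eq] at this
    lia
  have hl' : i ≠ l ∧ j ≠ l ∧ k ≠ l := by
    simp only [mem_insert, mem_singleton, not_or] at hl
    exact ⟨Ne.symm hl.1, Ne.symm hl.2.1, Ne.symm hl.2.2⟩
  constructor
  · intro h
    obtain ⟨x, hx, rfl⟩ := exists_cubicSyndrome_eq hq {l, i, j, k}
      (by rw [card_insert_of_notMem hl, h3]) s
    rw [cubicForm_cubicSyndrome_of_subset hx] at h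
    simp only [mul_eq_zero, bracket_lineCoord_eq_zero, hl'.1, hl'.2.1, hl'.2.2, or_false] at h
    refine ⟨x, fun m hm => ?_, rfl⟩
    rcases mem_insert.1 (hx hm) with rfl | hm'
    · exact absurd h (mem_wordSupport.1 hm)
    · exact hm'
  · rintro ⟨x, hx, rfl⟩
    have hxl : x l = 0 := by
      by_contra h0
      exact hl (hx (mem_wordSupport.2 h0))
    rw [cubicForm_cubicSyndrome_of_subset (i := l) (hx.trans (subset_insert _ _)), hxl, zero_mul]

/-- Three points are independent, so a set of three carries at most one word with syndrome s, and
words can be replaced by their supports. -/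
lemma syndromeCount_three (hq : 3 ≤ Fintype.card F) (s : Fin 4 → F) :
    syndromeCount (cubicSyndrome F) s 3 =
      #{S ∈ powersetCard 3 (univ : Finset (OnePoint F)) |
        ∃ x, wordSupport x = S ∧ cubicSyndrome F x = s} := by
  refine card_nbij wordSupport ?_ ?_ ?_
  · intro x hx
    simp only [coe_filter, mem_univ, true_and, Set.mem_ofPred_eq, mem_powersetCard_univ] at hx ⊢
    exact ⟨hx.2, x, rfl, hx.1⟩
  · intro x hx y hy hxy
    simp only [coe_filter, mem_univ, true_and, Set.mem_ofPred_eq] at hx hy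
    refine eq_of_cubicSyndrome_eq hq (hx.1.trans hy.1.symm) ?_
    rw [hxy, union_idempotent, card_wordSupport, hy.2]
    norm_num
  · intro S hS
    simp only [coe_filter, Set.mem_ofPred_eq, mem_powersetCard_univ] at hS
    obtain ⟨hS, x, rfl, hx⟩ := hS
    exact ⟨x, by simpa using ⟨hx, hS⟩, rfl⟩

/-- The number of words of weight three in a coset, when the triples of points spanning them
correspond to triples in a group with a given product. -/
theorem six_mul_syndromeCount_three (hq : 3 ≤ Fintype.card F) {G : Type*} [CommGroup G] [Fintype G]
    [DecidableEq G] (s : Fin 4 → F) (Z : Finset (OnePoint F)) (φ : OnePoint F → G) (c : G)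
    (hφ : Set.InjOn φ {i | i ∉ Z}) (hG : Fintype.card G + #Z ≤ Fintype.card F + 1)
    (h : ∀ i j k, i ≠ j → i ≠ k → j ≠ k → ((∃ x, wordSupport x = {i, j, k} ∧ cubicSyndrome F x = s) ↔
      (i ∉ Z ∧ j ∉ Z ∧ k ∉ Z) ∧ φ i * φ j * φ k = c)) :
    6 * syndromeCount (cubicSyndrome F) s 3 + 3 * Fintype.card G =
      Fintype.card G ^ 2 + 2 * #{g : G | g ^ 3 = c} := by
  -- `φ` is injective off `Z`, and `hG` says that the complement of `Z` is at least as large as the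
  -- group.
  have hsurj : ∀ g : G, ∃ i, i ∉ Z ∧ φ i = g := by
    intro g
    obtain ⟨i, hi, h⟩ := surj_on_of_inj_on_of_card_le (s := Zᶜ) (t := univ) (fun i _ => φ i)
      (by simp) (fun i j hi hj hij => hφ (by simpa using hi) (by simpa using hj) hij)
      (by rw [card_compl, card_univ, OnePoint.card_eq]; lia) g (mem_univ g)
    exact ⟨i, by simpa using hi, h.symm⟩
  rw [syndromeCount_three hq, ← card_distinct_triples_eq_six_mul, ← card_distinct_triples_prod]
  congr 1
  refine card_nbij (fun t => (φ t.1, φ t.2.1, φ t.2.2)) ?_ ?_ ?_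
  · rintro ⟨i, j, k⟩ ht
    simp only [coe_filter, mem_univ, true_and, Set.mem_ofPred_eq] at ht ⊢
    obtain ⟨⟨hij, hik, hjk⟩, hx⟩ := ht
    obtain ⟨⟨hi, hj, hk⟩, hc⟩ := (h i j k hij hik hjk).1 hx
    exact ⟨⟨hφ.ne hi hj hij, hφ.ne hi hk hik, hφ.ne hj hk hjk⟩, hc⟩
  · rintro ⟨i, j, k⟩ ht ⟨i', j', k'⟩ ht' heq
    simp only [coe_filter, mem_univ, true_and, Set.mem_ofPred_eq, Prod.mk.injEq] at ht ht' heq ⊢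
    obtain ⟨⟨hi, hj, hk⟩, -⟩ := (h i j k ht.1.1 ht.1.2.1 ht.1.2.2).1 ht.2
    obtain ⟨⟨hi', hj', hk'⟩, -⟩ := (h i' j' k' ht'.1.1 ht'.1.2.1 ht'.1.2.2).1 ht'.2
    exact ⟨hφ hi hi' heq.1, hφ hj hj' heq.2.1, hφ hk hk' heq.2.2⟩
  · rintro ⟨x, y, z⟩ ht
    simp only [coe_filter, mem_univ, true_and, Set.mem_ofPred_eq] at ht
    obtain ⟨i, hi, rfl⟩ := hsurj x
    obtain ⟨j, hj, rfl⟩ := hsurj y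
    obtain ⟨k, hk, rfl⟩ := hsurj z
    obtain ⟨⟨hij, hik, hjk⟩, hc⟩ := ht
    have hij' : i ≠ j := fun h => hij (h ▸ rfl)
    have hik' : i ≠ k := fun h => hik (h ▸ rfl)
    have hjk' : j ≠ k := fun h => hjk (h ▸ rfl)
    refine ⟨(i, j, k), ?_, rfl⟩
    simp only [coe_filter, mem_univ, true_and, Set.mem_ofPred_eq]
    exact ⟨⟨hij', hik', hjk'⟩, (h i j k hij' hik' hjk').2 ⟨⟨hi, hj, hk⟩, hc⟩⟩

end TwistedCubic

/-! ### Words of weight three for points on chords and tangents -/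

section Classification

variable {F : Type*} [Field F]

/-- The quotient is a projective coordinate on the line; injectivity is the Plücker relation among
four vectors of the plane. -/
lemma bracket_div_injOn {u v : F × F} (huv : bracket u v ≠ 0) {i j : OnePoint F}
    (hi : bracket (lineCoord i) v ≠ 0) (hj : bracket (lineCoord j) v ≠ 0)
    (h : bracket (lineCoord i) u / bracket (lineCoord i) v =
      bracket (lineCoord j) u / bracket (lineCoord j) v) : i = j := by
  rw [div_eq_div_iff hi hj] at h
  rw [← bracket_lineCoord_eq_zero]
  refine mul_left_cancel₀ huv ?_
  rw [mul_zero]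
  unfold bracket at h ⊢
  linear_combination h

lemma div_mul_div_mul_div_eq_iff {α β A₁ A₂ A₃ B₁ B₂ B₃ : F} (hα : α ≠ 0) (h₁ : B₁ ≠ 0)
    (h₂ : B₂ ≠ 0) (h₃ : B₃ ≠ 0) : A₁ / B₁ * (A₂ / B₂) * (A₃ / B₃) = -β / α ↔
      α * (A₁ * A₂ * A₃) + β * (B₁ * B₂ * B₃) = 0 := by
  rw [div_mul_div_comm, div_mul_div_comm, div_eq_div_iff (mul_ne_zero (mul_ne_zero h₁ h₂) h₃) hα]
  constructor <;> intro h <;> linear_combination h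

variable [Fintype F] [DecidableEq F]

/-- Coplanarity only yields a support contained in the triple; the lower bound on the weight forces
equality. -/
lemma exists_wordSupport_eq_iff (hq : 3 ≤ Fintype.card F) {s : Fin 4 → F} {i j k : OnePoint F}
    (hij : i ≠ j) (hik : i ≠ k) (hjk : j ≠ k)
    (h : ∀ x, wordSupport x ⊆ {i, j, k} → cubicSyndrome F x = s → 3 ≤ hammingNorm x) :
    (∃ x, wordSupport x = {i, j, k} ∧ cubicSyndrome F x = s) ↔
      cubicForm (lineCoord i) (lineCoord j) (lineCoord k) s = 0 := by
  rw [cubicForm_eq_zero_iff hq hij hik hjk]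
  refine exists_congr fun x => and_congr_left fun hx => ⟨fun h => h.subset, fun hsub => ?_⟩
  exact eq_of_subset_of_card_le hsub (card_le_three.trans (h x hsub hx))

/-- Words of weight three in a coset of weight two. -/
theorem syndromeCount_three_of_chord (hq : 3 ≤ Fintype.card F) {x : OnePoint F → F}
    (hx : hammingNorm x = 2) :
    ∃ r, 6 * syndromeCount (cubicSyndrome F) (cubicSyndrome F x) 3 + 3 * (Fintype.card F - 1) =
      (Fintype.card F - 1) ^ 2 + 2 * r ∧ (Fintype.card F % 3 ≠ 1 → r = 1) ∧
      (Fintype.card F % 3 = 1 → r = 0 ∨ r = 3) := by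
  obtain ⟨a, b, hab, hsupp⟩ := card_eq_two.1 hx
  change wordSupport x = {a, b} at hsupp
  have ha : x a ≠ 0 := mem_wordSupport.1 (hsupp ▸ by simp)
  have hb : x b ≠ 0 := mem_wordSupport.1 (hsupp ▸ by simp)
  set la : F × F := lineCoord a
  set lb : F × F := lineCoord b
  let φ : OnePoint F → Fˣ := fun i => if h : bracket (lineCoord i) la / bracket (lineCoord i) lb ≠ 0
    then Units.mk0 _ h else 1
  have hφ : ∀ i, i ∉ ({a, b} : Finset _) →
      (φ i : F) = bracket (lineCoord i) la / bracket (lineCoord i) lb := by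
    intro i hi
    simp only [mem_insert, mem_singleton, not_or] at hi
    have : bracket (lineCoord i) la / bracket (lineCoord i) lb ≠ 0 :=
      div_ne_zero (bracket_lineCoord_eq_zero.not.2 hi.1) (bracket_lineCoord_eq_zero.not.2 hi.2)
    simp only [φ, dif_pos this, Units.val_mk0]
  let c : Fˣ := Units.mk0 (-(x b) / x a) (div_ne_zero (neg_ne_zero.2 hb) ha)
  refine ⟨#{g : Fˣ | g ^ 3 = c}, ?_, fun h => ?_, fun h => ?_⟩
  · rw [← Fintype.card_units]
    refine six_mul_syndromeCount_three hq _ {a, b} φ c ?_ ?_ ?_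
    · intro i hi j hj hij
      have h := congrArg Units.val hij
      rw [hφ i hi, hφ j hj] at h
      simp only [Set.mem_ofPred_eq, mem_insert, mem_singleton, not_or] at hi hj
      exact bracket_div_injOn (bracket_lineCoord_eq_zero.not.2 hab)
        (bracket_lineCoord_eq_zero.not.2 hi.2) (bracket_lineCoord_eq_zero.not.2 hj.2) h
    · rw [Fintype.card_units, card_pair hab]
      lia
    · intro i j k hij hik hjk
      -- If a word y of weight three met the support {a, b} of x, the two would involve at most four
      -- points and so coincide, despite their different weights.
      have hdisj : ∀ y, wordSupport y = {i, j, k} → cubicSyndrome F y = cubicSyndrome F x →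
          ∀ m ∈ ({i, j, k} : Finset _), m ∉ ({a, b} : Finset _) := by
        intro y hy hyx m hm hm'
        have hc : #(wordSupport y ∪ wordSupport x) ≤ 4 := by
          have h1 := card_union_add_card_inter (wordSupport y) (wordSupport x)
          have h2 : 0 < #(wordSupport y ∩ wordSupport x) :=
            card_pos.2 ⟨m, mem_inter.2 ⟨hy ▸ hm, hsupp ▸ hm'⟩⟩
          have h3 := card_le_three (a := i) (b := j) (c := k)
          rw [← hy] at h3
          rw [card_wordSupport x, hx] at h1
          lia
        have h3 : #(wordSupport y) = 3 := hy ▸ card_eq_three.2 ⟨_, _, _, hij, hik, hjk, rfl⟩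
        rw [eq_of_cubicSyndrome_eq hq hyx hc, card_wordSupport, hx] at h3
        norm_num at h3
      have hform : ∀ u v w : F × F, cubicForm u v w (cubicSyndrome F x) =
          x a * (bracket u la * bracket v la * bracket w la) +
          x b * (bracket u lb * bracket v lb * bracket w lb) := by
        intro u v w
        rw [cubicForm_cubicSyndrome]
        refine Fintype.sum_eq_add a b hab fun m hm => ?_
        have : x m = 0 := by
          by_contra h0
          have := hsupp ▸ mem_wordSupport.2 h0
          simp [hm.1, hm.2] at this
        rw [this, zero_mul]
      have hprod : (i ∉ ({a, b} : Finset _) ∧ j ∉ ({a, b} : Finset _) ∧ k ∉ ({a, b} : Finset _)) →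
          (φ i * φ j * φ k = c ↔
            cubicForm (lineCoord i) (lineCoord j) (lineCoord k) (cubicSyndrome F x) = 0) := by
        rintro ⟨hi, hj, hk⟩
        rw [Units.ext_iff, Units.val_mul, Units.val_mul, hφ i hi, hφ j hj, hφ k hk, hform]
        simp only [mem_insert, mem_singleton, not_or] at hi hj hk
        exact div_mul_div_mul_div_eq_iff ha (bracket_lineCoord_eq_zero.not.2 hi.2)
          (bracket_lineCoord_eq_zero.not.2 hj.2) (bracket_lineCoord_eq_zero.not.2 hk.2)
      constructor
      · rintro ⟨y, hy, hyx⟩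
        have hd := hdisj y hy hyx
        have hijk : i ∉ ({a, b} : Finset _) ∧ j ∉ ({a, b} : Finset _) ∧ k ∉ ({a, b} : Finset _) :=
          ⟨hd i (by simp), hd j (by simp), hd k (by simp)⟩
        exact ⟨hijk, (hprod hijk).2 ((cubicForm_eq_zero_iff hq hij hik hjk _).2
          ⟨y, hy.subset, hyx⟩)⟩
      · rintro ⟨hijk, hc⟩
        refine (exists_wordSupport_eq_iff hq hij hik hjk fun y hy hyx => ?_).2 ((hprod hijk).1 hc)
        by_contra! hlt
        have := eq_of_cubicSyndrome_eq_of_hammingNorm hq hyx (by lia)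
        have hai : a ∈ ({i, j, k} : Finset _) := hy (this ▸ mem_wordSupport.2 ha)
        simp only [mem_insert, mem_singleton, not_or] at hijk hai
        grind
  · refine card_cube_roots_of_coprime ?_ c
    rw [Fintype.card_units, Nat.coprime_comm, Nat.Prime.coprime_iff_not_dvd Nat.prime_three]
    lia
  · refine card_cube_roots_of_dvd ?_ c
    rw [Fintype.card_units]
    lia

/-- Words of weight three in the coset of a point of a tangent. -/
theorem syndromeCount_three_of_tangent (hq : 3 ≤ Fintype.card F) {a : OnePoint F} {α β : F}
    (hβ : β ≠ 0) (hs : ∀ x, cubicSyndrome F x = α • twistedCubicPoint a + β • tangentPoint a →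
      3 ≤ hammingNorm x) :
    ∃ r, 6 * syndromeCount (cubicSyndrome F) (α • twistedCubicPoint a + β • tangentPoint a) 3 +
      3 * Fintype.card F = Fintype.card F ^ 2 + 2 * r ∧ (Fintype.card F % 3 ≠ 0 → r = 1) ∧
      (Fintype.card F % 3 = 0 → r = 0 ∨ r = Fintype.card F) := by
  set la : F × F := lineCoord a
  set ma : F × F := lineCocoord a
  -- An affine coordinate with pole at a. Dividing the coplanarity equation by the three brackets
  -- with `la` turns it into a sum of three such coordinates.
  let φ : OnePoint F → Multiplicative F := fun i =>
    Multiplicative.ofAdd (bracket (lineCoord i) ma / bracket (lineCoord i) la)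
  let c : Multiplicative F := Multiplicative.ofAdd (-α / β)
  have hcard : Fintype.card (Multiplicative F) = Fintype.card F := Fintype.card_multiplicative F
  refine ⟨#{g : Multiplicative F | g ^ 3 = c}, ?_, fun h => ?_, fun h => ?_⟩
  · rw [← hcard]
    refine six_mul_syndromeCount_three hq _ {a} φ c ?_ ?_ ?_
    · intro i hi j hj hij
      simp only [Set.mem_ofPred_eq, mem_singleton] at hi hj
      refine bracket_div_injOn (u := ma) (v := la) ?_ (bracket_lineCoord_eq_zero.not.2 hi)
        (bracket_lineCoord_eq_zero.not.2 hj) (Multiplicative.ofAdd.injective hij)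
      intro h
      refine bracket_lineCocoord_ne_zero a ?_
      unfold bracket at h ⊢
      linear_combination -h
    · rw [hcard, card_singleton]
    · intro i j k hij hik hjk
      rw [exists_wordSupport_eq_iff hq hij hik hjk fun x _ hx => hs x hx, map_add, map_smul, map_smul,
        cubicForm_twistedCubicPoint, cubicForm_tangentPoint, smul_eq_mul, smul_eq_mul]
      have hne : ∀ m : OnePoint F, m ≠ a → bracket (lineCoord m) la ≠ 0 := fun m hm =>
        bracket_lineCoord_eq_zero.not.2 hm
      have haa : bracket (lineCoord a) la = 0 := bracket_lineCoord_eq_zero.2 rfl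
      have haa' : bracket (lineCoord a) ma ≠ 0 := bracket_lineCocoord_ne_zero a
      change α * (bracket (lineCoord i) la * bracket (lineCoord j) la * bracket (lineCoord k) la) +
        β * (bracket (lineCoord i) ma * bracket (lineCoord j) la * bracket (lineCoord k) la +
        bracket (lineCoord i) la * bracket (lineCoord j) ma * bracket (lineCoord k) la +
        bracket (lineCoord i) la * bracket (lineCoord j) la * bracket (lineCoord k) ma) = 0 ↔
        (i ∉ ({a} : Finset _) ∧ j ∉ ({a} : Finset _) ∧ k ∉ ({a} : Finset _)) ∧
        bracket (lineCoord i) ma / bracket (lineCoord i) la +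
        bracket (lineCoord j) ma / bracket (lineCoord j) la +
        bracket (lineCoord k) ma / bracket (lineCoord k) la = -α / β
      simp only [mem_singleton]
      constructor
      · intro h
        -- At i = a every bracket with `la` in that slot vanishes, leaving one nonzero term.
        have hia : i ≠ a := by
          rintro rfl
          simp [haa, hβ, haa', hne j hij.symm, hne k hik.symm] at h
        have hja : j ≠ a := by
          rintro rfl
          simp [haa, hβ, haa', hne i hij, hne k hjk.symm] at h
        have hka : k ≠ a := by
          rintro rfl
          simp [haa, hβ, haa', hne i hik, hne j hjk] at h
        refine ⟨⟨hia, hja, hka⟩, ?_⟩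
        have hi := hne i hia
        have hj := hne j hja
        have hk := hne k hka
        field_simp
        linear_combination h
      · rintro ⟨⟨hia, hja, hka⟩, h⟩
        have hi := hne i hia
        have hj := hne j hja
        have hk := hne k hka
        field_simp at h
        linear_combination h
  · refine card_cube_roots_of_coprime ?_ c
    rw [hcard, Nat.coprime_comm, Nat.Prime.coprime_iff_not_dvd Nat.prime_three]
    lia
  · have h3 : (3 : F) = 0 := by
      obtain ⟨p, hp, n, hpp, hpn⟩ := FiniteField.card' F
      have h3p : 3 ∣ p := Nat.prime_three.dvd_of_dvd_pow (hpn ▸ Nat.dvd_of_mod_eq_zero h)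
      obtain rfl := (Nat.prime_dvd_prime_iff_eq Nat.prime_three hpp).1 h3p
      exact_mod_cast CharP.cast_eq_zero F 3
    -- In characteristic three, cubing in the additive group is trivial: the cube roots of c are all
    -- elements or none.
    have hg : ∀ g : Multiplicative F, g ^ 3 = 1 := by
      intro g
      change (3 : ℕ) • Multiplicative.toAdd g = 0
      rw [nsmul_eq_mul, Nat.cast_ofNat, h3, zero_mul]
    by_cases hc : c = 1
    · right
      rw [← hcard, ← card_univ]
      congr 1
      simp [hg, hc]
    · left
      simp [hg, Ne.symm hc]

end Classification

/-! ### Points of the tangents: disjointness from chords, and their number -/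

section Tangent

variable {F : Type*} [Field F]

/-- With two arguments at a, each product in the form keeps a factor [a, a] = 0. Together with the
next nonvanishing statement this recovers a from s. -/
lemma cubicForm_eq_zero_of_tangent {a : OnePoint F} {α β : F} {s : Fin 4 → F}
    (hs : s = α • twistedCubicPoint a + β • tangentPoint a) (w : F × F) :
    cubicForm (lineCoord a) (lineCoord a) w s = 0 := by
  have haa : bracket (lineCoord a) (lineCoord a) = 0 := bracket_lineCoord_eq_zero.2 rfl
  rw [hs, map_add, map_smul, map_smul, cubicForm_twistedCubicPoint, cubicForm_tangentPoint]
  simp [haa]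

lemma exists_ne_onePoint (a : OnePoint F) : ∃ b, b ≠ a := by
  cases a using OnePoint.rec with
  | infty => exact ⟨(0 : F), OnePoint.coe_ne_infty _⟩
  | coe t => exact ⟨OnePoint.infty, OnePoint.infty_ne_coe _⟩

lemma cubicForm_ne_zero_of_tangent {a b : OnePoint F} (hab : b ≠ a) {α β : F} (hβ : β ≠ 0)
    {s : Fin 4 → F} (hs : s = α • twistedCubicPoint a + β • tangentPoint a) :
    cubicForm (lineCoord a) (lineCoord b) (lineCoord b) s ≠ 0 := by
  have haa : bracket (lineCoord a) (lineCoord a) = 0 := bracket_lineCoord_eq_zero.2 rfl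
  rw [hs, map_add, map_smul, map_smul, cubicForm_twistedCubicPoint, cubicForm_tangentPoint]
  simp [haa, hβ, bracket_lineCoord_eq_zero, hab, bracket_lineCocoord_ne_zero]

/-- A point of a tangent that is not on the cubic lies on no chord. -/
lemma tangent_ne_chord {a b c : OnePoint F} (hbc : b ≠ c) {α β γ δ : F} (hβ : β ≠ 0) :
    α • twistedCubicPoint a + β • tangentPoint a ≠
      γ • twistedCubicPoint b + δ • twistedCubicPoint c := by
  intro h
  have h0 := cubicForm_eq_zero_of_tangent h.symm
  obtain ⟨d, hd⟩ := exists_ne_onePoint a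
  have h1 := cubicForm_ne_zero_of_tangent hd hβ h.symm
  simp only [map_add, map_smul, cubicForm_twistedCubicPoint, smul_eq_mul] at h0 h1
  have hb := h0 (lineCoord b)
  have hc := h0 (lineCoord c)
  have hbb : bracket (lineCoord b) (lineCoord b) = 0 := bracket_lineCoord_eq_zero.2 rfl
  have hcc : bracket (lineCoord c) (lineCoord c) = 0 := bracket_lineCoord_eq_zero.2 rfl
  simp only [hbb, hcc, mul_zero, add_zero, zero_add, mul_eq_zero, or_self,
    bracket_lineCoord_eq_zero, hbc, hbc.symm, or_false] at hb hc
  apply h1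
  rcases hb with hb | rfl <;> rcases hc with hc | rfl
  · simp [hb, hc]
  · simp [hb, hbb]
  · simp [hc, hcc]
  · exact absurd rfl hbc

lemma tangent_injective {a b : OnePoint F} {α β γ δ : F} (hβ : β ≠ 0)
    (h : α • twistedCubicPoint a + β • tangentPoint a =
      γ • twistedCubicPoint b + δ • tangentPoint b) : a = b ∧ α = γ ∧ β = δ := by
  -- If a ≠ b, the form at (a, b, b) is nonzero since s is on the tangent at a, yet zero since s is
  -- on the tangent at b.
  have hab : a = b := by
    by_contra hab
    refine cubicForm_ne_zero_of_tangent (Ne.symm hab) hβ h.symm ?_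
    have h0 := cubicForm_eq_zero_of_tangent rfl (α := γ) (β := δ) (a := b) (lineCoord a)
    rw [cubicForm_apply] at h0 ⊢
    linear_combination h0
  subst hab
  refine ⟨rfl, ?_⟩
  cases a using OnePoint.rec with
  | infty =>
    have h2 := congrFun h 2
    have h3 := congrFun h 3
    simp [twistedCubicPoint, tangentPoint] at h2 h3
    exact ⟨h3, h2⟩
  | coe t =>
    have h0 := congrFun h 0
    have h1 := congrFun h 1
    simp [twistedCubicPoint, tangentPoint] at h0 h1
    subst h0
    exact ⟨rfl, by simpa using h1⟩

variable [Fintype F] [DecidableEq F]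

variable (F) in
/-- The points of the tangents that are not on the twisted cubic. -/
def tangentSet : Finset (Fin 4 → F) :=
  (univ ×ˢ (univ ×ˢ univ.erase 0) : Finset (OnePoint F × F × F)).image
    fun p => p.2.1 • twistedCubicPoint p.1 + p.2.2 • tangentPoint p.1

lemma card_tangentSet :
    #(tangentSet F) = (Fintype.card F + 1) * (Fintype.card F * (Fintype.card F - 1)) := by
  rw [tangentSet, card_image_of_injOn, card_product, card_product, card_erase_of_mem (mem_univ _),
    card_univ, card_univ, OnePoint.card_eq]
  rintro ⟨a, α, β⟩ h ⟨b, γ, δ⟩ - heq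
  simp only [coe_product, coe_univ, coe_erase, Set.mem_prod, Set.mem_univ, true_and,
    Set.mem_sdiff, Set.mem_singleton_iff] at h heq
  obtain ⟨rfl, rfl, rfl⟩ := tangent_injective h heq
  rfl

lemma mem_tangentSet {s : Fin 4 → F} : s ∈ tangentSet F ↔ ∃ (a : OnePoint F) (α β : F), β ≠ 0 ∧
    α • twistedCubicPoint a + β • tangentPoint a = s := by
  simp [tangentSet]

lemma exists_chord_of_hammingNorm_le_two {x : OnePoint F → F} (hx : hammingNorm x ≤ 2) :
    ∃ a b : OnePoint F, a ≠ b ∧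
      cubicSyndrome F x = x a • twistedCubicPoint a + x b • twistedCubicPoint b := by
  obtain ⟨U, hU, hU2⟩ := exists_superset_card_eq (s := wordSupport x) (n := 2) hx
    (by rw [OnePoint.card_eq]; have := Fintype.one_lt_card (α := F); lia)
  obtain ⟨a, b, hab, rfl⟩ := card_eq_two.1 hU2
  refine ⟨a, b, hab, ?_⟩
  rw [cubicSyndrome_apply]
  refine Fintype.sum_eq_add a b hab fun m hm => ?_
  have : x m = 0 := by
    by_contra h0
    have := hU (mem_wordSupport.2 h0)
    simp [hm.1, hm.2] at this
  rw [this, zero_smul]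

lemma three_le_hammingNorm_of_mem_tangentSet {s : Fin 4 → F} (hs : s ∈ tangentSet F)
    {x : OnePoint F → F} (hx : cubicSyndrome F x = s) : 3 ≤ hammingNorm x := by
  by_contra! h
  obtain ⟨a, b, hab, hx'⟩ := exists_chord_of_hammingNorm_le_two (Nat.le_of_lt_succ h)
  obtain ⟨c, α, β, hβ, rfl⟩ := mem_tangentSet.1 hs
  exact tangent_ne_chord hab hβ (hx.symm.trans hx')

lemma exists_hammingNorm_le_two {a b : OnePoint F} (hab : a ≠ b) (α β : F) :
    ∃ x, hammingNorm x ≤ 2 ∧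
      cubicSyndrome F x = α • twistedCubicPoint a + β • twistedCubicPoint b := by
  refine ⟨Pi.single a α + Pi.single b β, ?_, ?_⟩
  · rw [← card_pair hab, ← card_wordSupport]
    refine card_le_card fun m hm => ?_
    by_contra h
    simp only [mem_insert, mem_singleton, not_or] at h
    simp [h.1, h.2] at hm
  · simp [cubicSyndrome, map_add, Fintype.linearCombination_apply_single]

end Tangent

/-! ### Words of weight three for points on imaginary chords -/

section ImaginaryChord

variable {F : Type*} [Field F] [Fintype F]

/-- The q elements of F already exhaust the possible roots of X^q - X. -/
lemma mem_range_algebraMap_of_pow_card_eq {L : Type*} [Field L] [Algebra F L] {z : L}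
    (hz : z ^ Fintype.card F = z) : z ∈ Set.range (algebraMap F L) := by
  classical
  by_contra h
  let S : Finset L := insert z (univ.image (algebraMap F L))
  have hS : #S = Fintype.card F + 1 := by
    rw [card_insert_of_notMem (by simpa using h),
      card_image_of_injective _ (algebraMap F L).injective, card_univ]
  have hp := FiniteField.X_pow_card_sub_X_ne_zero L (Fintype.one_lt_card (α := F))
  have := Polynomial.card_le_degree_of_subset_roots (Z := S) (p := Polynomial.X ^ Fintype.card F - Polynomial.X)
    (by
      intro w hw
      rw [mem_val, mem_insert, mem_image] at hw
      rw [Polynomial.mem_roots hp]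
      rcases hw with rfl | ⟨t, -, rfl⟩
      · simp [hz]
      · simp [← map_pow, FiniteField.pow_card])
  rw [FiniteField.X_pow_card_sub_X_natDegree_eq L Fintype.one_lt_card, hS] at this
  lia

variable [DecidableEq F]

/-- Words of weight three in the coset of a point of an imaginary chord. -/
theorem syndromeCount_three_of_imaginary (hq : 3 ≤ Fintype.card F) {s : Fin 4 → F}
    (hs : ∀ x, cubicSyndrome F x = s → 3 ≤ hammingNorm x) {b c : F}
    (hroot : ∀ r, r ^ 2 + b * r + c ≠ 0) (h2 : s 2 = -b * s 1 - c * s 0)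
    (h3 : s 3 = -b * s 2 - c * s 1) :
    ∃ r, 6 * syndromeCount (cubicSyndrome F) s 3 + 3 * (Fintype.card F + 1) =
      (Fintype.card F + 1) ^ 2 + 2 * r ∧ (Fintype.card F % 3 ≠ 2 → r = 1) ∧
      (Fintype.card F % 3 = 2 → r = 0 ∨ r = 3) := by
  classical
  let L := AlgebraicClosure F
  let σ : L →ₐ[F] L := FiniteField.frobeniusAlgHom F L
  have hσ : ∀ z, σ z = z ^ Fintype.card F := fun z => rfl
  let ι : F →+* L := algebraMap F L
  have hισ : ∀ t, σ (ι t) = ι t := fun t => σ.commutes t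
  obtain ⟨θ, hθ⟩ : ∃ θ : L, θ ^ 2 + ι b * θ + ι c = 0 := by
    obtain ⟨θ, hθ⟩ := IsAlgClosed.exists_eval₂_eq_zero_of_injective ι ι.injective
      (Polynomial.X ^ 2 + Polynomial.C b * Polynomial.X + Polynomial.C c)
      (by
        have h : (Polynomial.X ^ 2 + Polynomial.C b * Polynomial.X + Polynomial.C c :
            Polynomial F).degree = 2 := by compute_degree!
        rw [h]
        norm_num)
    exact ⟨θ, by simpa using hθ⟩
  have hθF : ∀ t, ι t ≠ θ := by
    rintro t rfl
    refine hroot t (ι.injective ?_)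
    simpa using hθ
  have hσθ : σ θ ≠ θ := fun h => by
    obtain ⟨t, ht⟩ := mem_range_algebraMap_of_pow_card_eq h
    exact hθF t ht
  obtain ⟨θ', hθ'⟩ : ∃ θ', θ' = σ θ := ⟨_, rfl⟩
  -- The Frobenius conjugate θ' is a second root of the quadratic; subtracting the two equations and
  -- cancelling θ' - θ gives Vieta's formulas.
  have hsum : θ' + θ = - ι b := by
    have h := congrArg σ hθ
    simp only [map_add, map_mul, map_pow, hισ, map_zero, ← hθ'] at h
    have : (θ' - θ) * (θ' + θ + ι b) = 0 := by linear_combination h - hθ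
    rcases mul_eq_zero.1 this with h | h
    · exact absurd (hθ' ▸ sub_eq_zero.1 h) hσθ
    · linear_combination h
  have hprod : θ' * θ = ι c := by linear_combination θ * hsum - hθ
  have hσθ' : σ θ' = θ := by
    have h := congrArg σ hsum
    rw [map_add, map_neg, hισ, ← hθ', ← hsum] at h
    linear_combination h
  have hd : θ - θ' ≠ 0 := sub_ne_zero.2 fun h => hσθ (hθ' ▸ h.symm)
  -- The coefficients of s on the chord through the conjugate points at θ and θ', from α + α' = s 0
  -- and αθ + α'θ' = s 1. Since s is rational, Frobenius exchanges α and α'.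
  obtain ⟨α, hα⟩ : ∃ α, α = (ι (s 1) - θ' * ι (s 0)) / (θ - θ') := ⟨_, rfl⟩
  obtain ⟨α', hα'⟩ : ∃ α', α' = σ α := ⟨_, rfl⟩
  have hα'eq : α' = (θ * ι (s 0) - ι (s 1)) / (θ - θ') := by
    rw [hα', hα, map_div₀, map_sub, map_sub, map_mul, hισ, hισ, hσθ', ← hθ', ← neg_div_neg_eq]
    ring
  have hσα' : σ α' = α := by
    rw [hα'eq, hα, map_div₀, map_sub, map_sub, map_mul, hισ, hισ, hσθ', ← hθ', ← neg_div_neg_eq]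
    ring
  have e0 : ι (s 0) = α + α' := by
    rw [hα'eq, hα, ← add_div, eq_div_iff hd]
    ring
  have e1 : ι (s 1) = α * θ + α' * θ' := by
    rw [hα'eq, hα, div_mul_eq_mul_div, div_mul_eq_mul_div, ← add_div, eq_div_iff hd]
    ring
  have e2 : ι (s 2) = α * θ ^ 2 + α' * θ' ^ 2 := by
    rw [h2, map_sub, map_mul, map_mul, map_neg, e0, e1, ← hsum, ← hprod]
    ring
  have e3 : ι (s 3) = α * θ ^ 3 + α' * θ' ^ 3 := by
    rw [h3, map_sub, map_mul, map_mul, map_neg, e1, e2, ← hsum, ← hprod]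
    ring
  have hα0 : α ≠ 0 := by
    intro h
    have h' : α' = 0 := by rw [hα', h, map_zero]
    have hs0 : s = 0 := by
      ext i
      apply ι.injective
      fin_cases i <;> simp [e0, e1, e2, e3, h, h']
    have := hs 0 (by rw [map_zero, hs0])
    simp at this
  have hα'0 : α' ≠ 0 := by rw [hα']; exact (map_ne_zero σ).2 hα0
  let m : OnePoint F → L × L := fun i => (ι (lineCoord i).1, ι (lineCoord i).2)
  let A : OnePoint F → L := fun i => bracket (m i) (1, θ')
  let B : OnePoint F → L := fun i => bracket (m i) (1, θ)
  have hAB : ∀ i, σ (B i) = A i := by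
    intro i
    simp only [A, B, m, bracket, map_sub, map_mul, hισ, hθ', map_one]
  have hBA : ∀ i, σ (A i) = B i := by
    intro i
    simp only [A, B, m, bracket, map_sub, map_mul, hισ, hσθ', map_one]
  have hB0 : ∀ i, B i ≠ 0 := by
    intro i h
    cases i using OnePoint.rec with
    | infty => simp [B, m, bracket, lineCoord] at h
    | coe t =>
      simp [B, m, bracket, lineCoord] at h
      exact hθF t (by linear_combination -h)
  have hA0 : ∀ i, A i ≠ 0 := fun i => hAB i ▸ (map_ne_zero σ).2 (hB0 i)
  have hform : ∀ i j k, ι (cubicForm (lineCoord i) (lineCoord j) (lineCoord k) s) =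
      α' * (A i * A j * A k) + α * (B i * B j * B k) := by
    intro i j k
    rw [cubicForm_apply]
    simp only [map_add, map_sub, map_mul, map_neg, e0, e1, e2, e3, A, B, m, bracket]
    ring
  -- The quotients `A i / B i` and `-α / α'` are inverted by Frobenius z ↦ z^q, so they satisfy
  -- z^(q+1) = 1.
  let G := rootsOfUnity (Fintype.card F + 1) L
  have hmem : ∀ (z : L) (hz : z ≠ 0), σ z = z⁻¹ → Units.mk0 z hz ∈ G := by
    intro z hz h
    rw [mem_rootsOfUnity', Units.val_mk0, pow_succ, ← hσ, h, inv_mul_cancel₀ hz]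
  let φ : OnePoint F → G := fun i => ⟨Units.mk0 (A i / B i) (div_ne_zero (hA0 i) (hB0 i)),
    hmem _ _ (by rw [map_div₀, hAB, hBA, inv_div])⟩
  let d : G := ⟨Units.mk0 (-α / α') (div_ne_zero (neg_ne_zero.2 hα0) hα'0),
    hmem _ _ (by rw [map_div₀, map_neg, hσα', ← hα', inv_div, div_neg, neg_div])⟩
  have hφ : Function.Injective φ := by
    intro i j hij
    have h : A i / B i = A j / B j := congrArg (fun g : G => ((g : Lˣ) : L)) hij
    rw [div_eq_div_iff (hB0 i) (hB0 j)] at h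
    rw [← bracket_lineCoord_eq_zero]
    apply ι.injective
    refine mul_left_cancel₀ hd ?_
    rw [map_zero, mul_zero]
    simp only [A, B, m, bracket, map_sub, map_mul] at h ⊢
    linear_combination h
  let : Fintype G := Fintype.ofFinite G
  -- At most q + 1 roots of unity exist, and `φ` embeds the q + 1 points of the line into them.
  have hG : Fintype.card G = Fintype.card F + 1 := by
    refine le_antisymm ?_ ?_
    · rw [← Nat.card_eq_fintype_card]
      exact card_rootsOfUnity L _
    · rw [← OnePoint.card_eq]
      exact Fintype.card_le_of_injective φ hφ
  refine ⟨#{g : G | g ^ 3 = d}, ?_, fun h => ?_, fun h => ?_⟩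
  · rw [← hG]
    refine six_mul_syndromeCount_three hq _ ∅ φ d hφ.injOn (by rw [hG, card_empty]) ?_
    intro i j k hij hik hjk
    rw [exists_wordSupport_eq_iff hq hij hik hjk fun x _ hx => hs x hx,
      ← map_eq_zero_iff ι ι.injective, hform,
      ← div_mul_div_mul_div_eq_iff hα'0 (hB0 i) (hB0 j) (hB0 k)]
    simp only [notMem_empty, not_false_eq_true, and_self, true_and]
    rw [Subtype.ext_iff, Units.ext_iff]
    rfl
  · refine card_cube_roots_of_coprime ?_ d
    rw [hG, Nat.coprime_comm, Nat.Prime.coprime_iff_not_dvd Nat.prime_three]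
    lia
  · refine card_cube_roots_of_dvd ?_ d
    rw [hG]
    lia

end ImaginaryChord

/-! ### Weight of a syndrome and covering radius -/

section SyndromeWeight

variable {F : Type*} [Field F] [Fintype F] [DecidableEq F]

/-- The smallest weight of a word with a given syndrome. -/
noncomputable def syndromeWeight (s : Fin 4 → F) : ℕ :=
  sInf {w : ℕ | ∃ x, cubicSyndrome F x = s ∧ hammingNorm x = w}

lemma syndromeCount_ne_zero_iff {s : Fin 4 → F} {w : ℕ} :
    syndromeCount (cubicSyndrome F) s w ≠ 0 ↔ ∃ x, cubicSyndrome F x = s ∧ hammingNorm x = w := by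
  rw [syndromeCount, card_ne_zero]
  simp [Finset.Nonempty]

lemma syndromeCount_eq_zero_of_lt {s : Fin 4 → F} {w : ℕ} (h : w < syndromeWeight s) :
    syndromeCount (cubicSyndrome F) s w = 0 := by
  by_contra h0
  exact Nat.notMem_of_lt_sInf h (syndromeCount_ne_zero_iff.1 h0)

lemma syndromeWeight_le (x : OnePoint F → F) :
    syndromeWeight (cubicSyndrome F x) ≤ hammingNorm x :=
  Nat.sInf_le ⟨x, rfl, rfl⟩

lemma exists_hammingNorm_eq_syndromeWeight (hq : 3 ≤ Fintype.card F) (s : Fin 4 → F) :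
    ∃ x, cubicSyndrome F x = s ∧ hammingNorm x = syndromeWeight s := by
  obtain ⟨x, -, hx⟩ := exists_cubicSyndrome_eq hq univ
    (by rw [card_univ, OnePoint.card_eq]; lia) s
  exact Nat.sInf_mem (s := {w : ℕ | ∃ x, cubicSyndrome F x = s ∧ hammingNorm x = w}) ⟨_, x, hx, rfl⟩

/-- Two words with the same syndrome and total weight at most four coincide, so a word of weight w
can only be the minimal one. -/
lemma syndromeCount_of_add_le (hq : 3 ≤ Fintype.card F) {s : Fin 4 → F} {w : ℕ}
    (h : syndromeWeight s + w ≤ 4) :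
    syndromeCount (cubicSyndrome F) s w = if syndromeWeight s = w then 1 else 0 := by
  obtain ⟨x, hx, hxw⟩ := exists_hammingNorm_eq_syndromeWeight hq s
  have huniq : ∀ y, cubicSyndrome F y = s → hammingNorm y = w → y = x := fun y hy hyw =>
    eq_of_cubicSyndrome_eq_of_hammingNorm hq (hy.trans hx.symm) (by lia)
  split_ifs with hw
  · rw [syndromeCount, card_eq_one]
    refine ⟨x, ?_⟩
    ext y
    simp only [mem_filter, mem_univ, true_and, mem_singleton]
    constructor
    · rintro ⟨hy, hyw⟩
      exact huniq y hy hyw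
    · rintro rfl
      exact ⟨hx, hxw.trans hw⟩
  · rw [syndromeCount, card_eq_zero, filter_eq_empty_iff]
    rintro y - ⟨hy, hyw⟩
    rw [huniq y hy hyw] at hyw
    exact hw (hxw.symm.trans hyw)

lemma syndromeCount_of_le_two (hq : 3 ≤ Fintype.card F) (s : Fin 4 → F) {w : ℕ} (hw : w ≤ 2) :
    syndromeCount (cubicSyndrome F) s w = if syndromeWeight s = w then 1 else 0 := by
  by_cases h : syndromeWeight s ≤ 2
  · exact syndromeCount_of_add_le hq (by lia)
  · rw [syndromeCount_eq_zero_of_lt (by lia), if_neg (by lia)]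

lemma card_syndromeWeight_eq (hq : 3 ≤ Fintype.card F) {w : ℕ} (hw : w ≤ 2) :
    #{s : Fin 4 → F | syndromeWeight s = w} =
      (Fintype.card F + 1).choose w * (Fintype.card F - 1) ^ w := by
  rw [← OnePoint.card_eq, ← card_hammingNorm_eq, ← sum_syndromeCount (cubicSyndrome F), card_filter]
  exact sum_congr rfl fun s _ => (syndromeCount_of_le_two hq s hw).symm

lemma syndromeCount_three_of_weight_two (hq : 3 ≤ Fintype.card F) {s : Fin 4 → F}
    (hs : syndromeWeight s = 2) :
    ∃ r, 6 * syndromeCount (cubicSyndrome F) s 3 + 3 * (Fintype.card F - 1) =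
      (Fintype.card F - 1) ^ 2 + 2 * r ∧ (Fintype.card F % 3 ≠ 1 → r = 1) ∧
      (Fintype.card F % 3 = 1 → r = 0 ∨ r = 3) := by
  obtain ⟨x, rfl, hx⟩ := exists_hammingNorm_eq_syndromeWeight hq s
  exact syndromeCount_three_of_chord hq (hx.trans hs)

lemma three_le_syndromeWeight_iff (hq : 3 ≤ Fintype.card F) {s : Fin 4 → F} :
    3 ≤ syndromeWeight s ↔ ∀ x, cubicSyndrome F x = s → 3 ≤ hammingNorm x := by
  constructor
  · rintro h x rfl
    exact h.trans (syndromeWeight_le x)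
  · intro h
    obtain ⟨x, hx, hxw⟩ := exists_hammingNorm_eq_syndromeWeight hq s
    exact hxw ▸ h x hx

lemma syndromeCount_three_of_mem_tangentSet (hq : 3 ≤ Fintype.card F) {s : Fin 4 → F}
    (hs : s ∈ tangentSet F) :
    ∃ r, 6 * syndromeCount (cubicSyndrome F) s 3 + 3 * Fintype.card F =
      Fintype.card F ^ 2 + 2 * r ∧ (Fintype.card F % 3 ≠ 0 → r = 1) ∧
      (Fintype.card F % 3 = 0 → r = 0 ∨ r = Fintype.card F) := by
  have h := fun x hx => three_le_hammingNorm_of_mem_tangentSet (x := x) hs hx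
  obtain ⟨a, α, β, hβ, rfl⟩ := mem_tangentSet.1 hs
  exact syndromeCount_three_of_tangent hq hβ h

lemma syndromeCount_three_of_notMem_tangentSet (hq : 3 ≤ Fintype.card F) {s : Fin 4 → F}
    (hs : 3 ≤ syndromeWeight s) (hsT : s ∉ tangentSet F) :
    ∃ r, 6 * syndromeCount (cubicSyndrome F) s 3 + 3 * (Fintype.card F + 1) =
      (Fintype.card F + 1) ^ 2 + 2 * r ∧ (Fintype.card F % 3 ≠ 2 → r = 1) ∧
      (Fintype.card F % 3 = 2 → r = 0 ∨ r = 3) := by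
  rw [three_le_syndromeWeight_iff hq] at hs
  have hchord : ∀ (a b : OnePoint F) (α β : F), a ≠ b →
      s ≠ α • twistedCubicPoint a + β • twistedCubicPoint b := by
    rintro a b α β hab rfl
    obtain ⟨x, hx, hxs⟩ := exists_hammingNorm_le_two hab α β
    have := hs x hxs
    lia
  rcases exists_chord s with ⟨a, b, α, β, hab, h⟩ | ⟨a, α, β, h⟩ | ⟨b, c, hroot, h2, h3⟩
  · exact absurd h (hchord a b α β hab)
  · by_cases hβ : β = 0
    · obtain ⟨b, hb⟩ := exists_ne_onePoint a
      exact absurd (by simpa [hβ] using h) (hchord a b α 0 hb.symm)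
    · exact absurd (mem_tangentSet.2 ⟨a, α, β, hβ, h.symm⟩) hsT
  · exact syndromeCount_three_of_imaginary hq hs hroot h2 h3

/-- The covering radius of the code is at most three. -/
theorem syndromeWeight_le_three (hq : 5 ≤ Fintype.card F) (s : Fin 4 → F) :
    syndromeWeight s ≤ 3 := by
  by_contra! h
  -- With no word of weight three, the count would read 3n = n² + 2r with n = q or q + 1, impossible
  -- for n > 3.
  have h0 := syndromeCount_eq_zero_of_lt h
  by_cases hs : s ∈ tangentSet F
  · obtain ⟨r, hr, h1, -⟩ := syndromeCount_three_of_mem_tangentSet (by lia) hs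
    rw [h0] at hr
    by_cases hq5 : Fintype.card F = 5
    · rw [hq5] at hr
      lia
    · nlinarith
  · obtain ⟨r, hr, h1, -⟩ := syndromeCount_three_of_notMem_tangentSet (by lia) (by lia) hs
    rw [h0] at hr
    nlinarith

lemma syndromeWeight_of_mem_tangentSet (hq : 5 ≤ Fintype.card F) {s : Fin 4 → F}
    (hs : s ∈ tangentSet F) : syndromeWeight s = 3 :=
  le_antisymm (syndromeWeight_le_three hq s) ((three_le_syndromeWeight_iff (by lia)).2
    fun _ => three_le_hammingNorm_of_mem_tangentSet hs)

/-- Cosets of the same weight have the same distribution when they have the same number of words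
of weight three. -/
theorem syndromeCount_eq_iff (hq : 3 ≤ Fintype.card F) {s s' : Fin 4 → F}
    (h : syndromeWeight s = syndromeWeight s') :
    syndromeCount (cubicSyndrome F) s = syndromeCount (cubicSyndrome F) s' ↔
      syndromeCount (cubicSyndrome F) s 3 = syndromeCount (cubicSyndrome F) s' 3 := by
  refine ⟨fun h => congrFun h 3, fun h3 => syndromeCount_cubicSyndrome_eq hq fun w hw => ?_⟩
  rcases Nat.lt_succ_iff_lt_or_eq.1 hw with hw | rfl
  · rw [syndromeCount_of_le_two hq s (by lia), syndromeCount_of_le_two hq s' (by lia), h]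
  · exact h3

end SyndromeWeight

/-! ### Sizes of the families and the total number of words of weight three -/

section Counting

variable {F : Type*} [Field F] [Fintype F] [DecidableEq F]

variable (F) in
/-- The syndromes of weight three that are not on a tangent. -/
noncomputable def imaginarySet : Finset (Fin 4 → F) :=
  {s | syndromeWeight s = 3 ∧ s ∉ tangentSet F}

lemma mem_imaginarySet {s : Fin 4 → F} :
    s ∈ imaginarySet F ↔ syndromeWeight s = 3 ∧ s ∉ tangentSet F := by
  simp [imaginarySet]

lemma syndromeWeight_eq_three_iff (hq : 5 ≤ Fintype.card F) {s : Fin 4 → F} :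
    syndromeWeight s = 3 ↔ s ∈ tangentSet F ∨ s ∈ imaginarySet F := by
  rw [mem_imaginarySet]
  have := syndromeWeight_of_mem_tangentSet hq (s := s)
  tauto

lemma disjoint_tangentSet_imaginarySet : Disjoint (tangentSet F) (imaginarySet F) :=
  disjoint_right.2 fun _ hs => (mem_imaginarySet.1 hs).2

lemma sum_eq_sum_by_weight (hq : 5 ≤ Fintype.card F) (f : (Fin 4 → F) → ℚ) :
    ∑ s, f s = ∑ s with syndromeWeight s = 0, f s + ∑ s with syndromeWeight s = 1, f s +
      ∑ s with syndromeWeight s = 2, f s + ∑ s ∈ tangentSet F, f s + ∑ s ∈ imaginarySet F, f s := by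
  rw [← sum_fiberwise_of_maps_to (s := univ) (t := range 4) (g := syndromeWeight)
    (fun s _ => mem_range.2 (Nat.lt_succ_of_le (syndromeWeight_le_three hq s))),
    sum_range_succ, sum_range_succ, sum_range_succ, sum_range_one,
    add_assoc _ (∑ s ∈ tangentSet F, f s),
    ← sum_union disjoint_tangentSet_imaginarySet]
  congr 2
  ext s
  rw [mem_filter_univ, mem_union, syndromeWeight_eq_three_iff hq]

lemma natCast_choose_three (n : ℕ) : ((n.choose 3 : ℕ) : ℚ) = n * (n - 1) * (n - 2) / 6 := by
  induction n with
  | zero => simp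
  | succ n ih =>
    rw [Nat.choose_succ_succ, Nat.cast_add, ih, Nat.cast_choose_two]
    push_cast
    ring

lemma card_syndromes_weight_two (hq : 5 ≤ Fintype.card F) :
    (#{s : Fin 4 → F | syndromeWeight s = 2} : ℚ) =
      ((Fintype.card F : ℚ) ^ 3 - Fintype.card F) * (Fintype.card F - 1) / 2 := by
  rw [card_syndromeWeight_eq (by lia) le_rfl]
  push_cast [Nat.cast_choose_two, Nat.cast_sub (show 1 ≤ Fintype.card F by lia)]
  ring

lemma card_tangentSet_cast :
    (#(tangentSet F) : ℚ) = ((Fintype.card F : ℚ) ^ 2 + Fintype.card F) * (Fintype.card F - 1) := by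
  rw [card_tangentSet]
  push_cast [Nat.cast_sub (Fintype.card_pos (α := F))]
  ring

/-- What remains of the q^4 syndromes after those of weight 0, 1, 2 and the tangent points. -/
lemma card_imaginarySet (hq : 5 ≤ Fintype.card F) :
    (#(imaginarySet F) : ℚ) =
      ((Fintype.card F : ℚ) ^ 3 - Fintype.card F) * (Fintype.card F - 1) / 2 := by
  have h := sum_eq_sum_by_weight hq (fun _ => (1 : ℚ))
  simp only [sum_const, nsmul_eq_mul, mul_one, card_univ, Fintype.card_fun, Fintype.card_fin] at h
  rw [card_syndromeWeight_eq (by lia) (by lia : 0 ≤ 2),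
    card_syndromeWeight_eq (by lia) (by lia : 1 ≤ 2), card_syndromes_weight_two hq,
    card_tangentSet_cast] at h
  push_cast [Nat.choose_zero_right, Nat.choose_one_right,
    Nat.cast_sub (show 1 ≤ Fintype.card F by lia)] at h
  linear_combination -h

/-- Six times the number (q+1 choose 3)(q - 1)^3 of all words of weight three. Syndromes of weight 0
and 1 contribute nothing, since 1 + 3 ≤ 4. -/
lemma sum_syndromeCount_three (hq : 5 ≤ Fintype.card F) :
    ∑ s with syndromeWeight s = 2, 6 * (syndromeCount (cubicSyndrome F) s 3 : ℚ) +
      ∑ s ∈ tangentSet F, 6 * (syndromeCount (cubicSyndrome F) s 3 : ℚ) +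
      ∑ s ∈ imaginarySet F, 6 * (syndromeCount (cubicSyndrome F) s 3 : ℚ) =
      (Fintype.card F + 1) * Fintype.card F * (Fintype.card F - 1) ^ 4 := by
  have h := sum_eq_sum_by_weight hq (fun s => 6 * (syndromeCount (cubicSyndrome F) s 3 : ℚ))
  have hz : ∀ w ≤ 1, ∑ s with syndromeWeight s = w,
      6 * (syndromeCount (cubicSyndrome F) s 3 : ℚ) = 0 := by
    intro w hw
    refine sum_eq_zero fun s hs => ?_
    rw [mem_filter_univ] at hs
    rw [syndromeCount_of_add_le (by lia) (by lia), if_neg (by lia)]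
    simp
  rw [hz 0 (by lia), hz 1 le_rfl, zero_add, zero_add] at h
  rw [← h, ← mul_sum, ← Nat.cast_sum, sum_syndromeCount, card_hammingNorm_eq, OnePoint.card_eq]
  push_cast [natCast_choose_three, Nat.cast_sub (show 1 ≤ Fintype.card F by lia)]
  ring

/-- Two linear equations for the two unknown fibre sizes, to be solved for the family that splits.
-/
lemma sum_eq_of_two_values {α : Type*} (S : Finset α) (f : α → ℚ) {u v : ℚ} (huv : u ≠ v)
    (h : ∀ s ∈ S, f s = u ∨ f s = v) :
    (#{s ∈ S | f s = u} : ℚ) + #{s ∈ S | f s = v} = #S ∧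
    ∑ s ∈ S, f s = u * #{s ∈ S | f s = u} + v * #{s ∈ S | f s = v} := by
  have hv : ({s ∈ S | f s = v}) = {s ∈ S | ¬ f s = u} := by
    refine filter_congr fun s hs => ⟨fun h => h ▸ huv.symm, fun h' => (h s hs).resolve_left h'⟩
  constructor
  · rw [hv]
    exact_mod_cast card_filter_add_card_filter_not (s := S) (fun s => f s = u)
  · rw [← sum_filter_add_sum_filter_not S (fun s => f s = u), ← hv,
      sum_congr rfl (fun s hs => (mem_filter.1 hs).2), sum_const, nsmul_eq_mul,
      sum_congr rfl (fun s hs => (mem_filter.1 hs).2), sum_const, nsmul_eq_mul]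
    ring

end Counting

/-! ### From cosets of the code to syndromes -/

section Transport

variable {F : Type*} [Field F] [Fintype F]

/-- Rescaling and relabelling the coordinates turns words indexed by `ι` into words indexed by the
points of the twisted cubic. -/
def rescaleEquiv {ι : Type*} (e : ι ≃ OnePoint F) (v : ι → F) (hv : ∀ j, v j ≠ 0) :
    (ι → F) ≃ (OnePoint F → F) where
  toFun x i := v (e.symm i) * x (e.symm i)
  invFun y j := (v j)⁻¹ * y (e j)
  left_inv x := by ext j; simp [hv]
  right_inv y := by ext i; simp [hv]

lemma cubicSyndrome_rescaleEquiv {ι : Type*} [Fintype ι] (e : ι ≃ OnePoint F) (v : ι → F)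
    (hv : ∀ j, v j ≠ 0) (x : ι → F) :
    cubicSyndrome F (rescaleEquiv e v hv x) = (cubicParityCheck e v).mulVecLin x := by
  rw [cubicSyndrome_apply]
  ext k
  rw [Finset.sum_apply, ← e.sum_comp, Matrix.mulVecLin_apply, Matrix.mulVec, dotProduct]
  refine sum_congr rfl fun j _ => ?_
  simp [rescaleEquiv, cubicParityCheck]
  ring

variable [DecidableEq F]

variable (F) in
/-- The weight distributions of the cosets of weight `W`, in terms of syndromes. -/
def syndromeDistributions (W : ℕ) : Set (ℕ → ℕ) :=
  {D | ∃ s : Fin 4 → F, syndromeWeight s = W ∧ syndromeCount (cubicSyndrome F) s = D}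

variable (F) in
/-- The number of cosets of weight `W` with weight distribution `D`, in terms of syndromes. -/
noncomputable def numSyndromes (W : ℕ) (D : ℕ → ℕ) : ℕ :=
  {s : Fin 4 → F | syndromeWeight s = W ∧ syndromeCount (cubicSyndrome F) s = D}.ncard

lemma hammingNorm_rescaleEquiv {ι : Type*} [Fintype ι] (e : ι ≃ OnePoint F) (v : ι → F)
    (hv : ∀ j, v j ≠ 0) (x : ι → F) : hammingNorm (rescaleEquiv e v hv x) = hammingNorm x := by
  refine card_nbij' e.symm e ?_ ?_ ?_ ?_ <;> simp [rescaleEquiv, hv, Set.MapsTo, Set.LeftInvOn]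

/-- Cosets correspond to syndromes, compatibly with weights and weight distributions. -/
theorem exists_equiv_syndrome (hq : 3 ≤ Fintype.card F) {ι : Type*} [Fintype ι]
    (e : ι ≃ OnePoint F) (v : ι → F) (hv : ∀ j, v j ≠ 0) :
    ∃ Ψ : ((ι → F) ⧸ cubicCode e v) ≃ (Fin 4 → F), (∀ V, cosetWeight V = syndromeWeight (Ψ V)) ∧
      ∀ V, cosetWeightDistribution V = syndromeCount (cubicSyndrome F) (Ψ V) := by
  have hsurj : Function.Surjective (cubicParityCheck e v).mulVecLin := by
    intro s
    obtain ⟨x, -, hx⟩ := exists_cubicSyndrome_eq hq univ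
      (by rw [card_univ, OnePoint.card_eq]; lia) s
    refine ⟨(rescaleEquiv e v hv).symm x, ?_⟩
    rw [← cubicSyndrome_rescaleEquiv e v hv, Equiv.apply_symm_apply, hx]
  let Ψ := (cubicParityCheck e v).mulVecLin.quotKerEquivOfSurjective hsurj
  have hΨ : ∀ (x : ι → F) (V : (ι → F) ⧸ cubicCode e v), Submodule.Quotient.mk x = V ↔
      cubicSyndrome F (rescaleEquiv e v hv x) = Ψ V := by
    intro x V
    rw [cubicSyndrome_rescaleEquiv, ← LinearMap.quotKerEquivOfSurjective_apply_mk _ hsurj]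
    exact Ψ.injective.eq_iff.symm
  have hex : ∀ (V : (ι → F) ⧸ cubicCode e v) (w : ℕ),
      (∃ x : ι → F, Submodule.Quotient.mk x = V ∧ hammingNorm x = w) ↔
        ∃ x, cubicSyndrome F x = Ψ V ∧ hammingNorm x = w := by
    intro V w
    refine (rescaleEquiv e v hv).exists_congr fun x => ?_
    rw [hΨ, hammingNorm_rescaleEquiv]
  refine ⟨Ψ.toEquiv, fun V => ?_, fun V => ?_⟩
  · unfold cosetWeight syndromeWeight
    congr 1
    ext w
    exact hex V w
  · funext w
    rw [cosetWeightDistribution, syndromeCount, ← Set.ncard_coe_finset,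
      ← Set.ncard_image_of_injective _ (rescaleEquiv e v hv).injective]
    congr 1
    ext y
    rw [Equiv.image_eq_preimage_symm]
    have hy := hammingNorm_rescaleEquiv e v hv ((rescaleEquiv e v hv).symm y)
    rw [Equiv.apply_symm_apply] at hy
    simp only [Set.mem_preimage, Set.mem_ofPred_eq, hΨ, Equiv.apply_symm_apply, ← hy, coe_filter,
      mem_univ, true_and]
    rfl

theorem distributionsOfWeight_cubicCode (hq : 3 ≤ Fintype.card F) {ι : Type*} [Fintype ι]
    (e : ι ≃ OnePoint F) (v : ι → F) (hv : ∀ j, v j ≠ 0) (W : ℕ) :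
    distributionsOfWeight (cubicCode e v) W = syndromeDistributions F W := by
  obtain ⟨Ψ, hW, hD⟩ := exists_equiv_syndrome hq e v hv
  ext D
  unfold distributionsOfWeight syndromeDistributions
  simp only [Set.mem_ofPred_eq, hW, hD]
  exact Ψ.exists_congr_left.trans (by simp)

theorem numCosets_cubicCode (hq : 3 ≤ Fintype.card F) {ι : Type*} [Fintype ι]
    (e : ι ≃ OnePoint F) (v : ι → F) (hv : ∀ j, v j ≠ 0) (W : ℕ) (D : ℕ → ℕ) :
    numCosets (cubicCode e v) W D = numSyndromes F W D := by
  obtain ⟨Ψ, hW, hD⟩ := exists_equiv_syndrome hq e v hv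
  rw [numCosets, numSyndromes, ← Set.ncard_image_of_injective _ Ψ.injective]
  congr 1
  ext s
  rw [Equiv.image_eq_preimage_symm]
  simp [hW, hD]

/-- The weight distributions of a given weight, listed by the numbers of words of weight three. -/
theorem exists_distributions (hq : 3 ≤ Fintype.card F) (W : ℕ) {κ : Type*} (u n : κ → ℚ)
    (hu : Function.Injective u)
    (h : ∀ s : Fin 4 → F, syndromeWeight s = W →
      ∃ k, 6 * (syndromeCount (cubicSyndrome F) s 3 : ℚ) = u k)
    (hn : ∀ k, (#{s : Fin 4 → F | syndromeWeight s = W ∧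
      6 * (syndromeCount (cubicSyndrome F) s 3 : ℚ) = u k} : ℚ) = n k)
    (hn0 : ∀ k, n k ≠ 0) :
    ∃ D : κ → ℕ → ℕ, Function.Injective D ∧ syndromeDistributions F W = Set.range D ∧
      ∀ k, (numSyndromes F W (D k) : ℚ) = n k := by
  -- A nonzero count means that the value `u k` is attained; a syndrome attaining it represents the
  -- distribution `D k`.
  have hex : ∀ k, ∃ s : Fin 4 → F, syndromeWeight s = W ∧
      6 * (syndromeCount (cubicSyndrome F) s 3 : ℚ) = u k := by
    intro k
    have h0 := hn0 k
    rw [← hn k, Nat.cast_ne_zero, card_ne_zero] at h0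
    obtain ⟨s, hs⟩ := h0
    exact ⟨s, by simpa using hs⟩
  choose t htW ht using hex
  have key : ∀ s k, syndromeWeight s = W →
      (syndromeCount (cubicSyndrome F) s = syndromeCount (cubicSyndrome F) (t k) ↔
        6 * (syndromeCount (cubicSyndrome F) s 3 : ℚ) = u k) := by
    intro s k hs
    rw [syndromeCount_eq_iff hq (hs.trans (htW k).symm), ← ht k, mul_right_inj' (by norm_num),
      Nat.cast_inj]
  refine ⟨fun k => syndromeCount (cubicSyndrome F) (t k), fun k l hkl => hu ?_, ?_, fun k => ?_⟩
  · rw [← ht k]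
    exact (key (t k) l (htW k)).1 hkl
  · ext D
    constructor
    · rintro ⟨s, hs, rfl⟩
      obtain ⟨k, hk⟩ := h s hs
      exact ⟨k, ((key s k hs).2 hk).symm⟩
    · rintro ⟨k, rfl⟩
      exact ⟨t k, htW k, rfl⟩
  · rw [← hn k, numSyndromes, ← Set.ncard_coe_finset]
    congr 2
    ext s
    simp only [Set.mem_ofPred_eq, coe_filter, mem_univ, true_and]
    exact and_congr_right fun hs => key s k hs

end Transport

/-! ### The residue classes of q modulo 3 -/

section Cases

variable {F : Type*} [Field F] [Fintype F] [DecidableEq F]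

lemma six_mul_of_weight_two (hq : 3 ≤ Fintype.card F) {s : Fin 4 → F}
    (hs : syndromeWeight s = 2) :
    ∃ r : ℕ, 6 * (syndromeCount (cubicSyndrome F) s 3 : ℚ) =
      ((Fintype.card F : ℚ) - 1) * (Fintype.card F - 4) + 2 * r ∧
      (Fintype.card F % 3 ≠ 1 → r = 1) ∧ (Fintype.card F % 3 = 1 → r = 0 ∨ r = 3) := by
  obtain ⟨r, hr, h⟩ := syndromeCount_three_of_weight_two hq hs
  refine ⟨r, ?_, h⟩
  have := congrArg (Nat.cast : ℕ → ℚ) hr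
  push_cast [Nat.cast_sub (show 1 ≤ Fintype.card F by lia)] at this
  linear_combination this

lemma six_mul_of_mem_tangentSet (hq : 3 ≤ Fintype.card F) {s : Fin 4 → F}
    (hs : s ∈ tangentSet F) :
    ∃ r : ℕ, 6 * (syndromeCount (cubicSyndrome F) s 3 : ℚ) =
      (Fintype.card F : ℚ) * (Fintype.card F - 3) + 2 * r ∧
      (Fintype.card F % 3 ≠ 0 → r = 1) ∧
      (Fintype.card F % 3 = 0 → r = 0 ∨ r = Fintype.card F) := by
  obtain ⟨r, hr, h⟩ := syndromeCount_three_of_mem_tangentSet hq hs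
  refine ⟨r, ?_, h⟩
  have := congrArg (Nat.cast : ℕ → ℚ) hr
  push_cast at this
  linear_combination this

lemma six_mul_of_mem_imaginarySet (hq : 3 ≤ Fintype.card F) {s : Fin 4 → F}
    (hs : s ∈ imaginarySet F) :
    ∃ r : ℕ, 6 * (syndromeCount (cubicSyndrome F) s 3 : ℚ) =
      ((Fintype.card F : ℚ) + 1) * (Fintype.card F - 2) + 2 * r ∧
      (Fintype.card F % 3 ≠ 2 → r = 1) ∧ (Fintype.card F % 3 = 2 → r = 0 ∨ r = 3) := by
  rw [mem_imaginarySet] at hs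
  obtain ⟨r, hr, h⟩ := syndromeCount_three_of_notMem_tangentSet hq hs.1.ge hs.2
  refine ⟨r, ?_, h⟩
  have := congrArg (Nat.cast : ℕ → ℚ) hr
  push_cast at this
  linear_combination this

lemma card_weight_three_filter (hq : 5 ≤ Fintype.card F) (P : (Fin 4 → F) → Prop)
    [DecidablePred P] : #{s : Fin 4 → F | syndromeWeight s = 3 ∧ P s} =
      #{s ∈ tangentSet F | P s} + #{s ∈ imaginarySet F | P s} := by
  rw [← card_union_of_disjoint
    (disjoint_filter_filter disjoint_tangentSet_imaginarySet), ← filter_union]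
  congr 1
  ext s
  rw [mem_filter_univ, mem_filter, mem_union, syndromeWeight_eq_three_iff hq]

lemma sum_eq_of_one_value {α : Type*} (S : Finset α) (f : α → ℚ) {u : ℚ}
    (h : ∀ s ∈ S, f s = u) : ∑ s ∈ S, f s = u * #S := by
  rw [sum_congr rfl h, sum_const, nsmul_eq_mul, mul_comm]

lemma exists_unique_distribution (hq : 3 ≤ Fintype.card F) {W : ℕ} {s₀ : Fin 4 → F}
    (hs₀ : syndromeWeight s₀ = W) {u : ℚ}
    (h : ∀ s : Fin 4 → F, syndromeWeight s = W →
      6 * (syndromeCount (cubicSyndrome F) s 3 : ℚ) = u) :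
    ∃ D, syndromeDistributions F W = {D} := by
  refine ⟨syndromeCount (cubicSyndrome F) s₀, Set.eq_singleton_iff_unique_mem.2
    ⟨⟨s₀, hs₀, rfl⟩, ?_⟩⟩
  rintro _ ⟨s, hs, rfl⟩
  rw [syndromeCount_eq_iff hq (hs.trans hs₀.symm), ← Nat.cast_inj (R := ℚ)]
  linarith [h s hs, h s₀ hs₀]

lemma exists_syndromeWeight_eq (hq : 3 ≤ Fintype.card F) {w : ℕ} (hw : w ≤ 2) :
    ∃ s : Fin 4 → F, syndromeWeight s = w := by
  have h : 0 < #{s : Fin 4 → F | syndromeWeight s = w} := by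
    rw [card_syndromeWeight_eq hq hw]
    exact Nat.mul_pos (Nat.choose_pos (by lia)) (pow_pos (by lia) _)
  obtain ⟨s, hs⟩ := card_pos.1 h
  exact ⟨s, by simpa using hs⟩

theorem distributions_weight_one (hq : 3 ≤ Fintype.card F) :
    ∃ D, syndromeDistributions F 1 = {D} := by
  obtain ⟨s₀, hs₀⟩ := exists_syndromeWeight_eq hq (F := F) (show 1 ≤ 2 by lia)
  refine exists_unique_distribution hq hs₀ (u := 0) fun s hs => ?_
  rw [syndromeCount_of_add_le hq (by lia), if_neg (by lia)]
  simp

theorem distributions_weight_two (hq : 3 ≤ Fintype.card F) (h3 : Fintype.card F % 3 ≠ 1) :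
    ∃ D, syndromeDistributions F 2 = {D} := by
  obtain ⟨s₀, hs₀⟩ := exists_syndromeWeight_eq hq (F := F) le_rfl
  refine exists_unique_distribution hq hs₀
    (u := ((Fintype.card F : ℚ) - 1) * (Fintype.card F - 4) + 2) fun s hs => ?_
  obtain ⟨r, hr, h1, -⟩ := six_mul_of_weight_two hq hs
  rw [hr, h1 h3, Nat.cast_one, mul_one]

/-- The numbers of syndromes with two given values, packaged as weight distributions. -/
lemma exists_two_distributions (hq : 3 ≤ Fintype.card F) (W : ℕ) {u₁ u₂ n₁ n₂ : ℚ} (hu : u₁ ≠ u₂)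
    (h : ∀ s : Fin 4 → F, syndromeWeight s = W →
      6 * (syndromeCount (cubicSyndrome F) s 3 : ℚ) = u₁ ∨
      6 * (syndromeCount (cubicSyndrome F) s 3 : ℚ) = u₂)
    (h₁ : (#{s : Fin 4 → F | syndromeWeight s = W ∧
      6 * (syndromeCount (cubicSyndrome F) s 3 : ℚ) = u₁} : ℚ) = n₁)
    (h₂ : (#{s : Fin 4 → F | syndromeWeight s = W ∧
      6 * (syndromeCount (cubicSyndrome F) s 3 : ℚ) = u₂} : ℚ) = n₂)
    (hn₁ : n₁ ≠ 0) (hn₂ : n₂ ≠ 0) :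
    ∃ D₁ D₂, D₁ ≠ D₂ ∧ syndromeDistributions F W = {D₁, D₂} ∧
      (numSyndromes F W D₁ : ℚ) = n₁ ∧ (numSyndromes F W D₂ : ℚ) = n₂ := by
  obtain ⟨D, hinj, hD, hn⟩ := exists_distributions hq W ![u₁, u₂] ![n₁, n₂]
    (fun i j hij => by fin_cases i <;> fin_cases j <;> simp_all)
    (fun s hs => by simpa [Fin.exists_fin_two] using h s hs)
    (Fin.forall_fin_two.2 ⟨h₁, h₂⟩) (Fin.forall_fin_two.2 ⟨hn₁, hn₂⟩)
  refine ⟨D 0, D 1, hinj.ne (by decide), ?_, hn 0, hn 1⟩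
  rw [hD]
  ext d
  simp [Fin.exists_fin_two, eq_comm]

lemma exists_three_distributions (hq : 3 ≤ Fintype.card F) (W : ℕ) {u₁ u₂ u₃ n₁ n₂ n₃ : ℚ}
    (hu₁₂ : u₁ ≠ u₂) (hu₁₃ : u₁ ≠ u₃) (hu₂₃ : u₂ ≠ u₃)
    (h : ∀ s : Fin 4 → F, syndromeWeight s = W →
      6 * (syndromeCount (cubicSyndrome F) s 3 : ℚ) = u₁ ∨
      6 * (syndromeCount (cubicSyndrome F) s 3 : ℚ) = u₂ ∨
      6 * (syndromeCount (cubicSyndrome F) s 3 : ℚ) = u₃)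
    (h₁ : (#{s : Fin 4 → F | syndromeWeight s = W ∧
      6 * (syndromeCount (cubicSyndrome F) s 3 : ℚ) = u₁} : ℚ) = n₁)
    (h₂ : (#{s : Fin 4 → F | syndromeWeight s = W ∧
      6 * (syndromeCount (cubicSyndrome F) s 3 : ℚ) = u₂} : ℚ) = n₂)
    (h₃ : (#{s : Fin 4 → F | syndromeWeight s = W ∧
      6 * (syndromeCount (cubicSyndrome F) s 3 : ℚ) = u₃} : ℚ) = n₃)
    (hn₁ : n₁ ≠ 0) (hn₂ : n₂ ≠ 0) (hn₃ : n₃ ≠ 0) :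
    ∃ D₁ D₂ D₃, D₁ ≠ D₂ ∧ D₁ ≠ D₃ ∧ D₂ ≠ D₃ ∧ syndromeDistributions F W = {D₁, D₂, D₃} ∧
      (numSyndromes F W D₁ : ℚ) = n₁ ∧ (numSyndromes F W D₂ : ℚ) = n₂ ∧
      (numSyndromes F W D₃ : ℚ) = n₃ := by
  obtain ⟨D, hinj, hD, hn⟩ := exists_distributions hq W ![u₁, u₂, u₃] ![n₁, n₂, n₃]
    (fun i j hij => by fin_cases i <;> fin_cases j <;> simp_all)
    (fun s hs => by simpa [Fin.exists_fin_succ] using h s hs)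
    (fun k => by fin_cases k; exacts [h₁, h₂, h₃])
    (fun k => by fin_cases k; exacts [hn₁, hn₂, hn₃])
  refine ⟨D 0, D 1, D 2, hinj.ne (by decide), hinj.ne (by decide), hinj.ne (by decide), ?_,
    hn 0, hn 1, hn 2⟩
  rw [hD]
  ext d
  simp [Fin.exists_fin_succ, eq_comm]

theorem distributions_weight_two_of_mod_three_eq_one (hq : 5 ≤ Fintype.card F)
    (h3 : Fintype.card F % 3 = 1) :
    ∃ D₁ D₂, D₁ ≠ D₂ ∧ syndromeDistributions F 2 = {D₁, D₂} ∧
      (numSyndromes F 2 D₁ : ℚ) =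
        ((Fintype.card F : ℚ) ^ 3 - Fintype.card F) * (Fintype.card F - 1) / 3 ∧
      (numSyndromes F 2 D₂ : ℚ) =
        ((Fintype.card F : ℚ) ^ 3 - Fintype.card F) * (Fintype.card F - 1) / 6 := by
  have hq' : (5 : ℚ) ≤ Fintype.card F := by exact_mod_cast hq
  have hsum := sum_syndromeCount_three hq
  have hcR := card_syndromes_weight_two hq
  have hcT := card_tangentSet_cast (F := F)
  have hcI := card_imaginarySet hq
  generalize hQ : (Fintype.card F : ℚ) = q at *
  have hpos : 0 < (q ^ 3 - q) * (q - 1) := mul_pos (by nlinarith) (by linarith)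
  have hR : ∀ s : Fin 4 → F, syndromeWeight s = 2 →
      6 * (syndromeCount (cubicSyndrome F) s 3 : ℚ) = (q - 1) * (q - 4) ∨
      6 * (syndromeCount (cubicSyndrome F) s 3 : ℚ) = (q - 1) * (q - 4) + 6 := by
    intro s hs
    obtain ⟨r, hr, -, h1⟩ := six_mul_of_weight_two (by lia) hs
    rw [hr, hQ]
    rcases h1 h3 with rfl | rfl <;> norm_num
  have hT := sum_eq_of_one_value (tangentSet F)
    (fun s => 6 * (syndromeCount (cubicSyndrome F) s 3 : ℚ)) (u := q * (q - 3) + 2) fun s hs => by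
      obtain ⟨r, hr, h1, -⟩ := six_mul_of_mem_tangentSet (by lia) hs
      rw [hr, h1 (by lia), hQ, Nat.cast_one, mul_one]
  have hI := sum_eq_of_one_value (imaginarySet F)
    (fun s => 6 * (syndromeCount (cubicSyndrome F) s 3 : ℚ)) (u := (q + 1) * (q - 2) + 2)
    fun s hs => by
      obtain ⟨r, hr, h1, -⟩ := six_mul_of_mem_imaginarySet (by lia) hs
      rw [hr, h1 (by lia), hQ, Nat.cast_one, mul_one]
  obtain ⟨hc, hs⟩ := sum_eq_of_two_values {s : Fin 4 → F | syndromeWeight s = 2}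
    (fun s => 6 * (syndromeCount (cubicSyndrome F) s 3 : ℚ))
    (u := (q - 1) * (q - 4)) (v := (q - 1) * (q - 4) + 6) (by norm_num)
    (fun s hs => hR s (mem_filter.1 hs).2)
  rw [filter_filter, filter_filter] at hc hs
  rw [hT, hI, hs, hcT, hcI] at hsum
  rw [hcR] at hc
  refine exists_two_distributions (by lia) 2 (u₁ := (q - 1) * (q - 4))
    (u₂ := (q - 1) * (q - 4) + 6) (by norm_num) hR ?_ ?_ (by positivity) (by positivity)
  -- Solving x + y = `#R` and ux + (u + 6)y = total, with R the syndromes of weight two: the gap 6 =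
  -- 2·3 between the values explains the division by 6.
  · linear_combination (1 + (q - 1) * (q - 4) / 6) * hc - hsum / 6
  · linear_combination -((q - 1) * (q - 4) / 6) * hc + hsum / 6

theorem distributions_weight_three_of_mod_three_eq_one (hq : 5 ≤ Fintype.card F)
    (h3 : Fintype.card F % 3 = 1) :
    ∃ D₁ D₂, D₁ ≠ D₂ ∧ syndromeDistributions F 3 = {D₁, D₂} ∧
      (numSyndromes F 3 D₁ : ℚ) =
        ((Fintype.card F : ℚ) ^ 2 + Fintype.card F) * (Fintype.card F - 1) ∧
      (numSyndromes F 3 D₂ : ℚ) =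
        ((Fintype.card F : ℚ) ^ 3 - Fintype.card F) * (Fintype.card F - 1) / 2 := by
  have hq' : (5 : ℚ) ≤ Fintype.card F := by exact_mod_cast hq
  have hcT := card_tangentSet_cast (F := F)
  have hcI := card_imaginarySet hq
  generalize hQ : (Fintype.card F : ℚ) = q at *
  have hpos : 0 < (q ^ 3 - q) * (q - 1) := mul_pos (by nlinarith) (by linarith)
  have hpos' : 0 < (q ^ 2 + q) * (q - 1) := mul_pos (by nlinarith) (by linarith)
  have hne : q * (q - 3) + 2 ≠ (q + 1) * (q - 2) + 2 := by
    intro h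
    linarith
  have hT : ∀ s ∈ tangentSet F,
      6 * (syndromeCount (cubicSyndrome F) s 3 : ℚ) = q * (q - 3) + 2 := fun s hs => by
    obtain ⟨r, hr, h1, -⟩ := six_mul_of_mem_tangentSet (by lia) hs
    rw [hr, h1 (by lia), hQ, Nat.cast_one, mul_one]
  have hI : ∀ s ∈ imaginarySet F,
      6 * (syndromeCount (cubicSyndrome F) s 3 : ℚ) = (q + 1) * (q - 2) + 2 := fun s hs => by
    obtain ⟨r, hr, h1, -⟩ := six_mul_of_mem_imaginarySet (by lia) hs
    rw [hr, h1 (by lia), hQ, Nat.cast_one, mul_one]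
  refine exists_two_distributions (by lia) 3 hne
    (fun s hs => ((syndromeWeight_eq_three_iff hq).1 hs).imp (hT s) (hI s)) ?_ ?_
    hpos'.ne' (by positivity)
  · rw [card_weight_three_filter hq, filter_true_of_mem hT,
      filter_false_of_mem fun s hs h => hne (h.symm.trans (hI s hs)), card_empty, add_zero, hcT]
  · rw [card_weight_three_filter hq, filter_true_of_mem hI,
      filter_false_of_mem fun s hs h => hne ((hT s hs).symm.trans h), card_empty, zero_add, hcI]

theorem distributions_weight_three_of_mod_three_eq_two (hq : 5 ≤ Fintype.card F)
    (h3 : Fintype.card F % 3 = 2) :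
    ∃ D₁ D₂ D₃, D₁ ≠ D₂ ∧ D₁ ≠ D₃ ∧ D₂ ≠ D₃ ∧ syndromeDistributions F 3 = {D₁, D₂, D₃} ∧
      (numSyndromes F 3 D₁ : ℚ) =
        ((Fintype.card F : ℚ) ^ 2 + Fintype.card F) * (Fintype.card F - 1) ∧
      (numSyndromes F 3 D₂ : ℚ) =
        ((Fintype.card F : ℚ) ^ 3 - Fintype.card F) * (Fintype.card F - 1) / 3 ∧
      (numSyndromes F 3 D₃ : ℚ) =
        ((Fintype.card F : ℚ) ^ 3 - Fintype.card F) * (Fintype.card F - 1) / 6 := by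
  have hq' : (5 : ℚ) ≤ Fintype.card F := by exact_mod_cast hq
  have hsum := sum_syndromeCount_three hq
  have hcR := card_syndromes_weight_two hq
  have hcT := card_tangentSet_cast (F := F)
  have hcI := card_imaginarySet hq
  generalize hQ : (Fintype.card F : ℚ) = q at *
  have hpos : 0 < (q ^ 3 - q) * (q - 1) := mul_pos (by nlinarith) (by linarith)
  have hpos' : 0 < (q ^ 2 + q) * (q - 1) := mul_pos (by nlinarith) (by linarith)
  have hne : q * (q - 3) + 2 ≠ (q + 1) * (q - 2) := by
    intro h
    linarith
  have hne' : q * (q - 3) + 2 ≠ (q + 1) * (q - 2) + 6 := by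
    intro h
    linarith
  have hR := sum_eq_of_one_value {s : Fin 4 → F | syndromeWeight s = 2}
    (fun s => 6 * (syndromeCount (cubicSyndrome F) s 3 : ℚ)) (u := (q - 1) * (q - 4) + 2)
    fun s hs => by
      obtain ⟨r, hr, h1, -⟩ := six_mul_of_weight_two (by lia) (mem_filter.1 hs).2
      rw [hr, h1 (by lia), hQ, Nat.cast_one, mul_one]
  have hT : ∀ s ∈ tangentSet F,
      6 * (syndromeCount (cubicSyndrome F) s 3 : ℚ) = q * (q - 3) + 2 := fun s hs => by
    obtain ⟨r, hr, h1, -⟩ := six_mul_of_mem_tangentSet (by lia) hs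
    rw [hr, h1 (by lia), hQ, Nat.cast_one, mul_one]
  have hI : ∀ s ∈ imaginarySet F,
      6 * (syndromeCount (cubicSyndrome F) s 3 : ℚ) = (q + 1) * (q - 2) ∨
      6 * (syndromeCount (cubicSyndrome F) s 3 : ℚ) = (q + 1) * (q - 2) + 6 := fun s hs => by
    obtain ⟨r, hr, -, h1⟩ := six_mul_of_mem_imaginarySet (by lia) hs
    rw [hr, hQ]
    rcases h1 h3 with rfl | rfl <;> norm_num
  obtain ⟨hc, hs⟩ := sum_eq_of_two_values (imaginarySet F)
    (fun s => 6 * (syndromeCount (cubicSyndrome F) s 3 : ℚ)) (by norm_num) hI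
  rw [hR, sum_eq_of_one_value _ _ hT, hs, hcT, hcR] at hsum
  rw [hcI] at hc
  refine exists_three_distributions (by lia) 3 hne hne' (by norm_num)
    (fun s hs => ((syndromeWeight_eq_three_iff hq).1 hs).imp (hT s) (hI s)) ?_ ?_ ?_
    hpos'.ne' (by positivity) (by positivity)
  · rw [card_weight_three_filter hq, filter_true_of_mem hT, filter_false_of_mem fun s hs h => ?_,
      card_empty, add_zero, hcT]
    rcases hI s hs with h' | h'
    · exact hne (h.symm.trans h')
    · exact hne' (h.symm.trans h')
  · rw [card_weight_three_filter hq,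
      filter_false_of_mem fun s hs h => hne ((hT s hs).symm.trans h), card_empty, zero_add]
    linear_combination (1 + (q + 1) * (q - 2) / 6) * hc - hsum / 6
  · rw [card_weight_three_filter hq,
      filter_false_of_mem fun s hs h => hne' ((hT s hs).symm.trans h), card_empty, zero_add]
    linear_combination -((q + 1) * (q - 2) / 6) * hc + hsum / 6

theorem distributions_weight_three_of_mod_three_eq_zero (hq : 5 ≤ Fintype.card F)
    (h3 : Fintype.card F % 3 = 0) :
    ∃ D₁ D₂, D₁ ≠ D₂ ∧ syndromeDistributions F 3 = {D₁, D₂} ∧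
      (numSyndromes F 3 D₁ : ℚ) = ((Fintype.card F : ℚ) ^ 2 - 1) * (Fintype.card F - 1) ∧
      (numSyndromes F 3 D₂ : ℚ) =
        ((Fintype.card F : ℚ) + 1) * ((Fintype.card F : ℚ) ^ 2 - Fintype.card F + 2) *
          (Fintype.card F - 1) / 2 := by
  have hq' : (5 : ℚ) ≤ Fintype.card F := by exact_mod_cast hq
  have hsum := sum_syndromeCount_three hq
  have hcR := card_syndromes_weight_two hq
  have hcT := card_tangentSet_cast (F := F)
  have hcI := card_imaginarySet hq
  generalize hQ : (Fintype.card F : ℚ) = q at *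
  have hpos : 0 < (q ^ 2 - 1) * (q - 1) := mul_pos (by nlinarith) (by linarith)
  have hpos' : 0 < (q + 1) * (q ^ 2 - q + 2) * (q - 1) :=
    mul_pos (mul_pos (by linarith) (by nlinarith)) (by linarith)
  have hne : q * (q - 3) ≠ q * (q - 3) + 2 * q := by
    intro h
    linarith
  have hR := sum_eq_of_one_value {s : Fin 4 → F | syndromeWeight s = 2}
    (fun s => 6 * (syndromeCount (cubicSyndrome F) s 3 : ℚ)) (u := (q - 1) * (q - 4) + 2)
    fun s hs => by
      obtain ⟨r, hr, h1, -⟩ := six_mul_of_weight_two (by lia) (mem_filter.1 hs).2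
      rw [hr, h1 (by lia), hQ, Nat.cast_one, mul_one]
  have hT : ∀ s ∈ tangentSet F,
      6 * (syndromeCount (cubicSyndrome F) s 3 : ℚ) = q * (q - 3) ∨
      6 * (syndromeCount (cubicSyndrome F) s 3 : ℚ) = q * (q - 3) + 2 * q := fun s hs => by
    obtain ⟨r, hr, -, h1⟩ := six_mul_of_mem_tangentSet (by lia) hs
    rw [hr]
    rcases h1 h3 with rfl | rfl <;> simp [hQ]
  -- The value (q + 1)(q - 2) + 2 equals q(q - 3) + 2q, so the imaginary points share their
  -- distribution with the tangent points having r = q. That merges three groups into two classes.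
  have hI : ∀ s ∈ imaginarySet F,
      6 * (syndromeCount (cubicSyndrome F) s 3 : ℚ) = q * (q - 3) + 2 * q := fun s hs => by
    obtain ⟨r, hr, h1, -⟩ := six_mul_of_mem_imaginarySet (by lia) hs
    rw [hr, h1 (by lia), hQ]
    ring
  obtain ⟨hc, hs⟩ := sum_eq_of_two_values (tangentSet F)
    (fun s => 6 * (syndromeCount (cubicSyndrome F) s 3 : ℚ)) hne hT
  rw [hR, sum_eq_of_one_value _ _ hI, hs, hcI, hcR] at hsum
  rw [hcT] at hc
  have hq0 : q ≠ 0 := by linarith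
  refine exists_two_distributions (by lia) 3 hne
    (fun s hs => ((syndromeWeight_eq_three_iff hq).1 hs).elim (hT s) fun h => Or.inr (hI s h)) ?_ ?_
    hpos.ne' (by positivity)
  · rw [card_weight_three_filter hq,
      filter_false_of_mem (s := imaginarySet F) fun s hs h => hne (h.symm.trans (hI s hs)),
      card_empty, add_zero]
    -- The two tangent values differ by 2q, so the linear system determines the sizes only after
    -- cancelling q.
    refine mul_left_cancel₀ hq0 ?_
    linear_combination (q * (q - 3) / 2 + q) * hc - hsum / 2
  · rw [card_weight_three_filter hq, filter_true_of_mem hI, Nat.cast_add, hcI]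
    refine mul_left_cancel₀ hq0 ?_
    linear_combination -(q * (q - 3) / 2) * hc + hsum / 2

end Cases

theorem theorem3p3 (q : ℕ) (hq : 5 ≤ q)
    {F : Type*} [Field F] [Fintype F] [DecidableEq F] (hF : Fintype.card F = q)
    (e : Fin (q + 1) ≃ OnePoint F) (v : Fin (q + 1) → F) (hv : ∀ j, v j ≠ 0) :
    (∃ D, distributionsOfWeight (cubicCode e v) 1 = {D}) ∧
    (q % 3 ≠ 1 → ∃ D, distributionsOfWeight (cubicCode e v) 2 = {D}) ∧
    (q % 3 = 1 → ∃ D₁ D₂, D₁ ≠ D₂ ∧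
      distributionsOfWeight (cubicCode e v) 2 = {D₁, D₂} ∧
      (numCosets (cubicCode e v) 2 D₁ : ℚ) = ((q : ℚ) ^ 3 - q) * (q - 1) / 3 ∧
      (numCosets (cubicCode e v) 2 D₂ : ℚ) = ((q : ℚ) ^ 3 - q) * (q - 1) / 6) ∧
    (q % 3 = 1 → ∃ D₁ D₂, D₁ ≠ D₂ ∧
      distributionsOfWeight (cubicCode e v) 3 = {D₁, D₂} ∧
      (numCosets (cubicCode e v) 3 D₁ : ℚ) = ((q : ℚ) ^ 2 + q) * (q - 1) ∧
      (numCosets (cubicCode e v) 3 D₂ : ℚ) = ((q : ℚ) ^ 3 - q) * (q - 1) / 2) ∧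
    (q % 3 = 2 → ∃ D₁ D₂ D₃, D₁ ≠ D₂ ∧ D₁ ≠ D₃ ∧ D₂ ≠ D₃ ∧
      distributionsOfWeight (cubicCode e v) 3 = {D₁, D₂, D₃} ∧
      (numCosets (cubicCode e v) 3 D₁ : ℚ) = ((q : ℚ) ^ 2 + q) * (q - 1) ∧
      (numCosets (cubicCode e v) 3 D₂ : ℚ) = ((q : ℚ) ^ 3 - q) * (q - 1) / 3 ∧
      (numCosets (cubicCode e v) 3 D₃ : ℚ) = ((q : ℚ) ^ 3 - q) * (q - 1) / 6) ∧
    (q % 3 = 0 → ∃ D₁ D₂, D₁ ≠ D₂ ∧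
      distributionsOfWeight (cubicCode e v) 3 = {D₁, D₂} ∧
      (numCosets (cubicCode e v) 3 D₁ : ℚ) = ((q : ℚ) ^ 2 - 1) * (q - 1) ∧
      (numCosets (cubicCode e v) 3 D₂ : ℚ) =
        ((q : ℚ) + 1) * ((q : ℚ) ^ 2 - q + 2) * (q - 1) / 2) := by
  subst hF
  have hq3 : 3 ≤ Fintype.card F := by lia
  simp only [distributionsOfWeight_cubicCode hq3 e v hv, numCosets_cubicCode hq3 e v hv]
  exact ⟨distributions_weight_one hq3, distributions_weight_two hq3,
    distributions_weight_two_of_mod_three_eq_one hq,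
    distributions_weight_three_of_mod_three_eq_one hq,
    distributions_weight_three_of_mod_three_eq_two hq,
    distributions_weight_three_of_mod_three_eq_zero hq⟩
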